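/- Let $K$ be a field and let $H$ be a bialgebra over $K$, i.e. a $K$-module with an associative multiplication $\mu_H$ and a coassociative comultiplication $\Delta_H$ satisfying $\Delta_H(xy)=\Delta_H(x)\Delta_H(y)$. Let $A$ be an $H$-comodule-algebra, i.e. an associative $K$-algebra with a linear map $\rho\colon A\to H\otimes A$, $\rho(a)=\sum a_{(-1)}\otimes a_{(0)}$, such that $(\mathrm{Id}_H\otimes\rho)\rho=(\Delta_H\otimes \mathrm{Id}_A)\rho$ and $\rho(ab)=\sum a_{(-1)}b_{(-1)}\otimes a_{(0)}b_{(0)}$. (No units or counits are required.) For $q\ge 1$ regard $H^{\otimes q}\otimes A$ as an $A$-bimodule by $a\cdot(y_1\otimes\cdots\otimes y_q\otimes c)=\sum a_{(-1)(1)}y_1\otimes\cdots\otimes a_{(-1)(q)}y_q\otimes a_{(0)}c$ and $(y_1\otimes\cdots\otimes y_q\otimes c)\cdot a=\sum y_1a_{(-1)(1)}\otimes\cdots\otimes y_qa_{(-1)(q)}\otimes c\,a_{(0)}$; for $q=0$ it is $A$ with its multiplication. Let $\rho^p\colon A^{\otimes p}\to H\otimes A^{\otimes p}$ be the diagonal coaction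 $a_1\otimes\cdots\otimes a_p\mapsto\sum a_{1(-1)}\cdots a_{p(-1)}\otimes a_{1(0)}\otimes\cdots\otimes a_{p(0)}$. Put $C^{0,q}=0$, let $C^{1,0}=\mathrm{Der}(A)$ be the module of derivations of $A$, and put $C^{p,q}=\mathrm{Hom}(A^{\otimes p},H^{\otimes q}\otimes A)$ for all other $p\ge1$, $q\ge0$. Let $d^{p,q}\colon C^{p,q}\to C^{p+1,q}$ be the Hochschild coboundary of $A$ with coefficients in $H^{\otimes q}\otimes A$, and let $b^{p,q}=\sum_{i=0}^{q+1}(-1)^i b^{p,q}[i]\colon C^{p,q}\to C^{p,q+1}$, where $b[0]\varphi=(\mathrm{Id}_{H^{\otimes q}}\otimes\rho)\circ\varphi$, $b[i]\varphi=(\mathrm{Id}_{H^{\otimes (q-i)}}\otimes\Delta_H\otimes\mathrm{Id}_{H^{\otimes(i-1)}\otimes A})\circ\varphi$ for $1\le i\le q$, and $b[q+1]\varphi=(\mathrm{Id}_H\otimes\varphi)\circ\rho^p$. A deformation of $A$ is a pair $\Theta=(R,\Pi)$ of formal power series $R=\sum_{n\ge0}\rho_nt^n$, $\Pi=\sum_{n\ge0}\pi_nt^n$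 with $\rho_n\in\mathrm{Hom}(A,H\otimes A)$, $\pi_n\in\mathrm{Hom}(A^{\otimes2},A)$, $\rho_0=\rho$, $\pi_0=\mu_A$, such that, with everything extended $t$-linearly, $(\mathrm{Id}_H\otimes R)\circ R=(\Delta_H\otimes \mathrm{Id}_A)\circ R$, $R\circ\Pi=(\mu_H\otimes\Pi)\circ(\mathrm{Id}_H\otimes\tau\otimes \mathrm{Id}_A)\circ R^{\otimes2}$ (where $\tau\colon A\otimes H\to H\otimes A$ is the twist), and $\Pi(\Pi(a,b),c)=\Pi(a,\Pi(b,c))$ for all $a,b,c\in A$. Its infinitesimal is $\theta_1=(\rho_1,\pi_1)$. A formal automorphism is a series $\Phi=\sum_{n\ge0}\phi_nt^n$ with $\phi_n\in\mathrm{End}(A)$, $\phi_0=\mathrm{Id}_A$, whose first non-zero $\phi_n$ with $n\ge1$ (if any) is a derivation. Deformations $(R,\Pi)$ and $(\overline R,\overline\Pi)$ are equivalent if $\overline R=(\mathrm{Id}_H\otimes\Phi^{-1})\circ R\circ\Phi$ and $\overline\Pi=\Phi^{-1}\circ\Pi\circ\Phi^{\otimes2}$ for some formal automorphism $\Phi$.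 $A$ is rigid if every deformation is equivalent to the trivial deformation $(\rho,\mu_A)$. Then the following hold. (0) $C_{\mathrm{CA}}^{**}(A)=\{C^{p,q},\,d^{p,q},\,(-1)^{p+1}b^{p,q}\}$ is a bicomplex: both families of differentials square to zero and they anticommute. Hence its total complex $C_{\mathrm{CA}}^*(A)$, $C_{\mathrm{CA}}^n(A)=\bigoplus_{p+q=n}C^{p,q}$, is a cochain complex; let $H^n_{\mathrm{CA}}(A)$ be its cohomology. (1) The infinitesimal $\theta_1=(\rho_1,\pi_1)\in C^2_{\mathrm{CA}}(A)=\mathrm{Hom}(A,H\otimes A)\oplus\mathrm{Hom}(A^{\otimes2},A)$ of any deformation $\Theta$ of $A$ is a $2$-cocycle, and its class in $H^2_{\mathrm{CA}}(A)$ is determined by the equivalence class of $\Theta$: equivalent deformations have infinitesimals with the same class. (2) If $H^2_{\mathrm{CA}}(A)=0$, then $A$ is rigid. -/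

import Mathlib

open scoped TensorProduct

universe w u

namespace ComoduleAlgebraDeformation

noncomputable section

/-! ### Iterated tensor products -/

section Tower

variable (K : Type w) [Field K] (V M : Type u) [AddCommGroup V] [Module K V]
  [AddCommGroup M] [Module K M]

/-- `Tower K V M n` is `V ⊗ (V ⊗ (⋯ ⊗ (V ⊗ M)))` with `n` factors `V`, that is,
`V^{⊗ n} ⊗ M`.  In particular `Tower K A A p` is `A^{⊗ (p+1)}`. -/
abbrev Tower : ℕ → ModuleCat.{u} K
  | 0 => ModuleCat.of K M
  | n + 1 => ModuleCat.of K (V ⊗[K] (Tower n))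

end Tower

/-! ### Bialgebras and comodule-algebras

Following the convention that a bialgebra is a module with an associative multiplication and a
compatible coassociative comultiplication, and that a comodule structure is a coassociative
coaction, no unit or counit is required. -/

section Structures

variable {K : Type w} [Field K] {H A : Type u}
  [NonUnitalRing H] [Module K H] [IsScalarTower K H H] [SMulCommClass K H H]
  [NonUnitalRing A] [Module K A] [IsScalarTower K A A] [SMulCommClass K A A]

/-- `Δ` makes the associative algebra `H` a bialgebra: it is coassociative and multiplicative. -/
structure IsBialgebra (Δ : H →ₗ[K] H ⊗[K] H) : Prop where
  coassoc : (TensorProduct.assoc K H H H).toLinearMap ∘ₗ Δ.rTensor H ∘ₗ Δ = Δ.lTensor H ∘ₗ Δ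
  comul_mul : Δ ∘ₗ LinearMap.mul' K H =
    TensorProduct.map (LinearMap.mul' K H) (LinearMap.mul' K H) ∘ₗ
      (TensorProduct.tensorTensorTensorComm K H H H H).toLinearMap ∘ₗ TensorProduct.map Δ Δ

/-- `ρ` makes the associative algebra `A` an `H`-comodule-algebra: it is an `H`-comodule structure
on `A` for which `μ_A` is a morphism of `H`-comodules, i.e.
`ρ ∘ μ_A = (μ_H ⊗ μ_A) ∘ (Id_H ⊗ τ_{(A,H)} ⊗ Id_A) ∘ ρ^{⊗ 2}`. -/
structure IsComoduleAlgebra (Δ : H →ₗ[K] H ⊗[K] H) (ρ : A →ₗ[K] H ⊗[K] A) : Prop where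
  coassoc : ρ.lTensor H ∘ₗ ρ = (TensorProduct.assoc K H H A).toLinearMap ∘ₗ Δ.rTensor A ∘ₗ ρ
  coact_mul : ρ ∘ₗ LinearMap.mul' K A =
    TensorProduct.map (LinearMap.mul' K H) (LinearMap.mul' K A) ∘ₗ
      (TensorProduct.tensorTensorTensorComm K H A H A).toLinearMap ∘ₗ TensorProduct.map ρ ρ

variable (K A) in
/-- The module `Der(A)` of derivations of `A`. -/
def Der : Submodule K (A →ₗ[K] A) where
  carrier := {φ | ∀ a b : A, φ (a * b) = a * φ b + φ a * b}
  add_mem' {φ ψ} hφ hψ a b := by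
    simp only [Set.mem_ofPred_eq] at hφ hψ
    simp only [LinearMap.add_apply, hφ, hψ, mul_add, add_mul]
    abel
  zero_mem' a b := by simp
  smul_mem' c φ hφ a b := by
    simp only [Set.mem_ofPred_eq] at hφ
    simp only [LinearMap.smul_apply, hφ, smul_add, mul_smul_comm, smul_mul_assoc]

end Structures

/-! ### The Hochschild coboundary -/

section Hochschild

variable {K : Type w} [Field K] {A M : Type u}
  [NonUnitalRing A] [Module K A] [IsScalarTower K A A] [SMulCommClass K A A]
  [AddCommGroup M] [Module K M]

variable (K A) in
/-- `mulAt K A n i : A^{⊗ (n+2)} → A^{⊗ (n+1)}` multiplies the tensor factors in the (zero-based)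
positions `i` and `i + 1`. -/
def mulAt : (n : ℕ) → Fin (n + 1) → (Tower K A A (n + 1) →ₗ[K] Tower K A A n)
  | 0, _ => LinearMap.mul' K A
  | n + 1, i =>
    Fin.cases
      ((LinearMap.mul' K A).rTensor (Tower K A A n) ∘ₗ
        (TensorProduct.assoc K A A (Tower K A A n)).symm.toLinearMap)
      (fun j => (mulAt n j).lTensor A) i

variable (K A) in
/-- The canonical isomorphism `A^{⊗ (n+2)} ≅ A^{⊗ (n+1)} ⊗ A` which splits off the last tensor
factor, as a linear map. -/
def splitLast : (n : ℕ) → (Tower K A A (n + 1) →ₗ[K] (Tower K A A n ⊗[K] A))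
  | 0 => LinearMap.id
  | n + 1 =>
    (TensorProduct.assoc K A (Tower K A A n) A).symm.toLinearMap ∘ₗ (splitLast n).lTensor A

/-- The Hochschild coboundary `Hom(A^{⊗ (n+1)}, M) → Hom(A^{⊗ (n+2)}, M)`, where `l` and `r` are
the left and right actions of `A` on `M`. -/
def hochschildD (l : A ⊗[K] M →ₗ[K] M) (r : M ⊗[K] A →ₗ[K] M) (n : ℕ) :
    (Tower K A A n →ₗ[K] M) →ₗ[K] (Tower K A A (n + 1) →ₗ[K] M) where
  toFun φ :=
    l ∘ₗ φ.lTensor A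
      + ∑ i : Fin (n + 1), (-1 : K) ^ ((i : ℕ) + 1) • (φ ∘ₗ mulAt K A n i)
      + (-1 : K) ^ (n + 2) • (r ∘ₗ φ.rTensor A ∘ₗ splitLast K A n)
  map_add' φ ψ := by
    simp only [LinearMap.lTensor_add, LinearMap.rTensor_add, LinearMap.comp_add,
      LinearMap.add_comp, smul_add, Finset.sum_add_distrib]
    abel
  map_smul' c φ := by
    simp only [LinearMap.lTensor_smul, LinearMap.rTensor_smul, LinearMap.comp_smul,
      LinearMap.smul_comp, smul_add, Finset.smul_sum, RingHom.id_apply]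
    simp only [smul_comm c]

end Hochschild

/-! ### The bimodules `H^{⊗ q} ⊗ A` and the vertical maps -/

section Coaction

variable {K : Type w} [Field K] {H A : Type u}
  [NonUnitalRing H] [Module K H] [IsScalarTower K H H] [SMulCommClass K H H]
  [NonUnitalRing A] [Module K A] [IsScalarTower K A A] [SMulCommClass K A A]

variable (K H A) in
/-- The factorwise multiplication of `H^{⊗ q} ⊗ A`. -/
def towerMul : (q : ℕ) → (Tower K H A q ⊗[K] Tower K H A q →ₗ[K] Tower K H A q)
  | 0 => LinearMap.mul' K A
  | q + 1 =>
    TensorProduct.map (LinearMap.mul' K H) (towerMul q) ∘ₗ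
      (TensorProduct.tensorTensorTensorComm K H (Tower K H A q) H (Tower K H A q)).toLinearMap

variable (A) in
/-- `Δ^q ⊗ Id_A : H ⊗ A → H^{⊗ (q+1)} ⊗ A`, where `Δ^q` is the `q`-fold iterated
comultiplication `x ↦ ∑ x_{(1)} ⊗ ⋯ ⊗ x_{(q+1)}`. -/
def comulIter (Δ : H →ₗ[K] H ⊗[K] H) : (q : ℕ) → (H ⊗[K] A →ₗ[K] Tower K H A (q + 1))
  | 0 => LinearMap.id
  | q + 1 =>
    (comulIter Δ q).lTensor H ∘ₗ (TensorProduct.assoc K H H A).toLinearMap ∘ₗ Δ.rTensor A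

/-- `a ↦ ∑ a_{(-1)(1)} ⊗ ⋯ ⊗ a_{(-1)(q)} ⊗ a_{(0)}`, where `ρ(a) = ∑ a_{(-1)} ⊗ a_{(0)}`; for
`q = 0` this is the identity of `A`. -/
def coactIter (Δ : H →ₗ[K] H ⊗[K] H) (ρ : A →ₗ[K] H ⊗[K] A) :
    (q : ℕ) → (A →ₗ[K] Tower K H A q)
  | 0 => LinearMap.id
  | q + 1 => comulIter A Δ q ∘ₗ ρ

/-- The left action of `A` on `H^{⊗ q} ⊗ A`:
`a · (y_1 ⊗ ⋯ ⊗ y_q ⊗ c) = ∑ a_{(-1)(1)} y_1 ⊗ ⋯ ⊗ a_{(-1)(q)} y_q ⊗ a_{(0)} c`;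
for `q = 0` it is left multiplication of `A` on itself. -/
def leftAct (Δ : H →ₗ[K] H ⊗[K] H) (ρ : A →ₗ[K] H ⊗[K] A) (q : ℕ) :
    A ⊗[K] Tower K H A q →ₗ[K] Tower K H A q :=
  towerMul K H A q ∘ₗ (coactIter Δ ρ q).rTensor (Tower K H A q)

/-- The right action of `A` on `H^{⊗ q} ⊗ A`:
`(y_1 ⊗ ⋯ ⊗ y_q ⊗ c) · a = ∑ y_1 a_{(-1)(1)} ⊗ ⋯ ⊗ y_q a_{(-1)(q)} ⊗ c a_{(0)}`;
for `q = 0` it is right multiplication of `A` on itself. -/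
def rightAct (Δ : H →ₗ[K] H ⊗[K] H) (ρ : A →ₗ[K] H ⊗[K] A) (q : ℕ) :
    Tower K H A q ⊗[K] A →ₗ[K] Tower K H A q :=
  towerMul K H A q ∘ₗ (coactIter Δ ρ q).lTensor (Tower K H A q)

/-- The diagonal coaction `ρ^{p+1} : A^{⊗ (p+1)} → H ⊗ A^{⊗ (p+1)}`. -/
def coactPow (ρ : A →ₗ[K] H ⊗[K] A) : (p : ℕ) → (Tower K A A p →ₗ[K] H ⊗[K] Tower K A A p)
  | 0 => ρ
  | p + 1 =>
    (LinearMap.mul' K H).rTensor (A ⊗[K] Tower K A A p) ∘ₗ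
      (TensorProduct.tensorTensorTensorComm K H A H (Tower K A A p)).toLinearMap ∘ₗ
        TensorProduct.map ρ (coactPow ρ p)

/-- `Id_{H^{⊗ q}} ⊗ ρ : H^{⊗ q} ⊗ A → H^{⊗ (q+1)} ⊗ A`. -/
def coactLast (ρ : A →ₗ[K] H ⊗[K] A) : (q : ℕ) → (Tower K H A q →ₗ[K] Tower K H A (q + 1))
  | 0 => ρ
  | q + 1 => (coactLast ρ q).lTensor H

variable (A) in
/-- `comulAt A Δ q j : H^{⊗ q} ⊗ A → H^{⊗ (q+1)} ⊗ A` applies `Δ` to the factor `H` in the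
(zero-based) position `j`, i.e. it is `Id_{H^{⊗ j}} ⊗ Δ ⊗ Id_{H^{⊗ (q-1-j)} ⊗ A}`. -/
def comulAt (Δ : H →ₗ[K] H ⊗[K] H) :
    (q : ℕ) → Fin q → (Tower K H A q →ₗ[K] Tower K H A (q + 1))
  | 0, j => Fin.elim0 j
  | q + 1, j =>
    Fin.cases
      ((TensorProduct.assoc K H H (Tower K H A q)).toLinearMap ∘ₗ Δ.rTensor (Tower K H A q))
      (fun i => (comulAt Δ q i).lTensor H) j

/-- The alternating sum `b = ∑_{i=0}^{q+1} (-1)^i b[i]` on `Hom(A^{⊗ (p+1)}, H^{⊗ q} ⊗ A)`, with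
`b[0] φ = (Id_{H^{⊗ q}} ⊗ ρ) ∘ φ`,
`b[i] φ = (Id_{H^{⊗ (q-i)}} ⊗ Δ ⊗ Id_{H^{⊗ (i-1)} ⊗ A}) ∘ φ` for `1 ≤ i ≤ q`, and
`b[q+1] φ = (Id_H ⊗ φ) ∘ ρ^{p+1}`. In the sum below the index `i` stands for `i + 1`. -/
def verticalB (Δ : H →ₗ[K] H ⊗[K] H) (ρ : A →ₗ[K] H ⊗[K] A) (p q : ℕ) :
    (Tower K A A p →ₗ[K] Tower K H A q) →ₗ[K] (Tower K A A p →ₗ[K] Tower K H A (q + 1)) where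
  toFun φ :=
    coactLast ρ q ∘ₗ φ
      + ∑ i : Fin q, (-1 : K) ^ ((i : ℕ) + 1) • (comulAt A Δ q i.rev ∘ₗ φ)
      + (-1 : K) ^ (q + 1) • (φ.lTensor H ∘ₗ coactPow ρ p)
  map_add' φ ψ := by
    simp only [LinearMap.lTensor_add, LinearMap.comp_add,
      LinearMap.add_comp, smul_add, Finset.sum_add_distrib]
    abel
  map_smul' c φ := by
    simp only [LinearMap.lTensor_smul, LinearMap.comp_smul,
      LinearMap.smul_comp, smul_add, Finset.smul_sum, RingHom.id_apply]
    simp only [smul_comm c]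

/-! ### The deformation bicomplex -/

variable (K H A) in
/-- The entry `C^{p+1,q}` of the deformation bicomplex as a submodule of
`Hom(A^{⊗ (p+1)}, H^{⊗ q} ⊗ A)`: it is `Der(A)` for `(p+1,q) = (1,0)`, and everything otherwise.
The column with first index `0` is zero and is omitted. -/
def entry : (p q : ℕ) → Submodule K (Tower K A A p →ₗ[K] Tower K H A q)
  | 0, 0 => Der K A
  | 0, _ + 1 => ⊤
  | _ + 1, _ => ⊤

variable (K H A) in
/-- The entry `C^{p+1,q}` of the deformation bicomplex. -/
abbrev C (p q : ℕ) : Type u := ↥(entry K H A p q)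

/-- The horizontal differential `d^{p+1,q} : C^{p+1,q} → C^{p+2,q}`, the Hochschild coboundary of
`A` with coefficients in `H^{⊗ q} ⊗ A`. -/
def d (Δ : H →ₗ[K] H ⊗[K] H) (ρ : A →ₗ[K] H ⊗[K] A) (p q : ℕ) :
    C K H A p q →ₗ[K] C K H A (p + 1) q :=
  (hochschildD (leftAct Δ ρ q) (rightAct Δ ρ q) p ∘ₗ (entry K H A p q).subtype).codRestrict
    (entry K H A (p + 1) q) (fun _ => trivial)

/-- The map `b^{p+1,q} : C^{p+1,q} → C^{p+1,q+1}`. -/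
def b (Δ : H →ₗ[K] H ⊗[K] H) (ρ : A →ₗ[K] H ⊗[K] A) (p q : ℕ) :
    C K H A p q →ₗ[K] C K H A p (q + 1) :=
  (verticalB Δ ρ p q ∘ₗ (entry K H A p q).subtype).codRestrict
    (entry K H A p (q + 1)) (fun _ => by cases p <;> trivial)

/-- The vertical differential `(-1)^{(p+1)+1} b^{p+1,q} : C^{p+1,q} → C^{p+1,q+1}`. -/
def v (Δ : H →ₗ[K] H ⊗[K] H) (ρ : A →ₗ[K] H ⊗[K] A) (p q : ℕ) :
    C K H A p q →ₗ[K] C K H A p (q + 1) :=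
  (-1 : K) ^ ((p + 1) + 1) • b Δ ρ p q

/-! ### The total complex and its cohomology -/

variable (K H A) in
/-- The degree `n` part `C^n = ⨁_{(p+1)+q=n} C^{p+1,q}` of the total complex. -/
def Tot (n : ℕ) : Type u :=
  (s : {s : ℕ × ℕ // (s.1 + 1) + s.2 = n}) → C K H A s.1.1 s.1.2

instance (n : ℕ) : AddCommGroup (Tot K H A n) :=
  inferInstanceAs (AddCommGroup
    ((s : {s : ℕ × ℕ // (s.1 + 1) + s.2 = n}) → C K H A s.1.1 s.1.2))

instance (n : ℕ) : Module K (Tot K H A n) :=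
  inferInstanceAs (Module K
    ((s : {s : ℕ × ℕ // (s.1 + 1) + s.2 = n}) → C K H A s.1.1 s.1.2))

variable (K H A) in
/-- The projection of `C^n` onto its component `C^{p+1,q}`. -/
def Tot.proj (n p q : ℕ) (h : (p + 1) + q = n) : Tot K H A n →ₗ[K] C K H A p q where
  toFun x := x ⟨(p, q), h⟩
  map_add' _ _ := rfl
  map_smul' _ _ := rfl

/-- The part of the total differential landing in `C^{p+1,q}` that is given by the horizontal
differential. -/
def totH (Δ : H →ₗ[K] H ⊗[K] H) (ρ : A →ₗ[K] H ⊗[K] A) (n : ℕ) :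
    (p q : ℕ) → (p + 1) + q = n + 1 → (Tot K H A n →ₗ[K] C K H A p q)
  | 0, _, _ => 0
  | p + 1, q, h => d Δ ρ p q ∘ₗ Tot.proj K H A n p q (by omega)

/-- The part of the total differential landing in `C^{p+1,q}` that is given by the vertical
differential. -/
def totV (Δ : H →ₗ[K] H ⊗[K] H) (ρ : A →ₗ[K] H ⊗[K] A) (n : ℕ) :
    (p q : ℕ) → (p + 1) + q = n + 1 → (Tot K H A n →ₗ[K] C K H A p q)
  | _, 0, _ => 0
  | p, q + 1, h => v Δ ρ p q ∘ₗ Tot.proj K H A n p q (by omega)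

/-- The total differential `C^n → C^{n+1}`. -/
def totD (Δ : H →ₗ[K] H ⊗[K] H) (ρ : A →ₗ[K] H ⊗[K] A) (n : ℕ) :
    Tot K H A n →ₗ[K] Tot K H A (n + 1) where
  toFun x s := totH Δ ρ n s.1.1 s.1.2 s.2 x + totV Δ ρ n s.1.1 s.1.2 s.2 x
  map_add' x y := by
    funext s
    simp only [map_add]
    exact add_add_add_comm _ _ _ _
  map_smul' c x := by
    funext s
    simp only [map_smul]
    exact (smul_add _ _ _).symm

/-- The `n`-cocycles of the deformation complex. -/
def cocycles (Δ : H →ₗ[K] H ⊗[K] H) (ρ : A →ₗ[K] H ⊗[K] A) (n : ℕ) :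
    Submodule K (Tot K H A n) :=
  LinearMap.ker (totD Δ ρ n)

/-- The `n`-coboundaries of the deformation complex. -/
def coboundaries (Δ : H →ₗ[K] H ⊗[K] H) (ρ : A →ₗ[K] H ⊗[K] A) :
    (n : ℕ) → Submodule K (Tot K H A n)
  | 0 => ⊥
  | n + 1 => LinearMap.range (totD Δ ρ n)

/-- The cohomology module `H^n_{CA}(A)`. -/
abbrev Cohomology (Δ : H →ₗ[K] H ⊗[K] H) (ρ : A →ₗ[K] H ⊗[K] A) (n : ℕ) : Type u :=
  cocycles Δ ρ n ⧸ (coboundaries Δ ρ n).submoduleOf (cocycles Δ ρ n)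

end Coaction

/-! ### Formal power series of linear maps -/

section Formal

variable {K : Type w} [Field K] {X Y Z X' Y' : Type u}
  [AddCommGroup X] [Module K X] [AddCommGroup Y] [Module K Y] [AddCommGroup Z] [Module K Z]
  [AddCommGroup X'] [Module K X'] [AddCommGroup Y'] [Module K Y']

variable (K X Y) in
/-- Formal power series `∑ f_n t^n` with coefficients in `Hom(X, Y)`. -/
abbrev Series : Type u := ℕ → (X →ₗ[K] Y)

/-- The constant series. -/
def Series.const (f : X →ₗ[K] Y) : Series K X Y := fun n => if n = 0 then f else 0

/-- Composition, extended bilinearly: `(∑ g_i t^i) ∘ (∑ f_j t^j) = ∑_n (∑_{i+j=n} g_i ∘ f_j) t^n`. -/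
def Series.comp (g : Series K Y Z) (f : Series K X Y) : Series K X Z :=
  fun n => ∑ s ∈ Finset.HasAntidiagonal.antidiagonal n, g s.1 ∘ₗ f s.2

/-- Tensor product, extended bilinearly:
`(∑ f_i t^i) ⊗ (∑ g_j t^j) = ∑_n (∑_{i+j=n} f_i ⊗ g_j) t^n`. -/
def Series.tensor (f : Series K X Y) (g : Series K X' Y') :
    Series K (X ⊗[K] X') (Y ⊗[K] Y') :=
  fun n => ∑ s ∈ Finset.HasAntidiagonal.antidiagonal n, TensorProduct.map (f s.1) (g s.2)

variable (K X) in
/-- The identity series. -/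
def Series.id : Series K X X := Series.const LinearMap.id

end Formal

/-! ### Deformations -/

section Deformation

variable {K : Type w} [Field K] {H A : Type u}
  [NonUnitalRing H] [Module K H] [IsScalarTower K H H] [SMulCommClass K H H]
  [NonUnitalRing A] [Module K A] [IsScalarTower K A A] [SMulCommClass K A A]

/-- `Θ = (R, P)`, with `R = ∑ ρ_n t^n` and `P = ∑ π_n t^n`, is a deformation of `A`. -/
structure IsDeformation (Δ : H →ₗ[K] H ⊗[K] H) (ρ : A →ₗ[K] H ⊗[K] A)
    (R : Series K A (H ⊗[K] A)) (P : Series K (A ⊗[K] A) A) : Prop where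
  /-- `ρ_0 = ρ` -/
  coact_zero : R 0 = ρ
  /-- `π_0 = μ_A` -/
  mul_zero : P 0 = LinearMap.mul' K A
  /-- `(Id_H ⊗ R) ∘ R = (Δ ⊗ Id_A) ∘ R` -/
  coassoc : ((Series.id K H).tensor R).comp R =
    (Series.const ((TensorProduct.assoc K H H A).toLinearMap ∘ₗ Δ.rTensor A)).comp R
  /-- `R ∘ P = (μ_H ⊗ P) ∘ (Id_H ⊗ τ ⊗ Id_A) ∘ R^{⊗ 2}` -/
  coact_mul : R.comp P =
    ((Series.const (LinearMap.mul' K H)).tensor P).comp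
      ((Series.const (TensorProduct.tensorTensorTensorComm K H A H A).toLinearMap).comp
        (R.tensor R))
  /-- `P(P(a,b),c) = P(a,P(b,c))` -/
  assoc : P.comp (P.tensor (Series.id K A)) =
    (P.comp ((Series.id K A).tensor P)).comp
      (Series.const (TensorProduct.assoc K A A A).toLinearMap)

/-- A formal automorphism of `A`: a series `∑ φ_n t^n` with `φ_0 = Id_A` whose first non-zero
`φ_n` with `n ≥ 1` (if there is one) is a derivation. -/
structure IsFormalAutomorphism (Φ : Series K A A) : Prop where
  zero : Φ 0 = LinearMap.id
  derivation : ∀ n, 1 ≤ n → Φ n ≠ 0 → (∀ m, 1 ≤ m → m < n → Φ m = 0) → Φ n ∈ Der K A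

/-- Equivalence of `Θ = (R, P)` and `Θ' = (R', P')`: there is a formal automorphism `Φ`, with
inverse series `Ψ = Φ⁻¹`, such that `R' = (Id_H ⊗ Φ⁻¹) ∘ R ∘ Φ` and `P' = Φ⁻¹ ∘ P ∘ Φ^{⊗ 2}`. -/
def Equivalent (R : Series K A (H ⊗[K] A)) (P : Series K (A ⊗[K] A) A)
    (R' : Series K A (H ⊗[K] A)) (P' : Series K (A ⊗[K] A) A) : Prop :=
  ∃ Φ Ψ : Series K A A, IsFormalAutomorphism Φ ∧
    Φ.comp Ψ = Series.id K A ∧ Ψ.comp Φ = Series.id K A ∧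
    R' = (((Series.id K H).tensor Ψ).comp R).comp Φ ∧
    P' = (Ψ.comp P).comp (Φ.tensor Φ)

/-- `A` is rigid: every deformation is equivalent to the trivial deformation `(ρ, μ_A)`. -/
def IsRigid (Δ : H →ₗ[K] H ⊗[K] H) (ρ : A →ₗ[K] H ⊗[K] A) : Prop :=
  ∀ (R : Series K A (H ⊗[K] A)) (P : Series K (A ⊗[K] A) A), IsDeformation Δ ρ R P →
    Equivalent R P (Series.const ρ) (Series.const (LinearMap.mul' K A))

/-- A pair `(ρ', π')` regarded as an element of
`C^2 = Hom(A, H ⊗ A) ⊕ Hom(A ⊗ A, A)`. -/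
def pairCochain (ρ' : A →ₗ[K] H ⊗[K] A) (π' : A ⊗[K] A →ₗ[K] A) : Tot K H A 2
  | ⟨(0, 1), _⟩ => ⟨ρ', trivial⟩
  | ⟨(1, 0), _⟩ => ⟨π', trivial⟩
  | ⟨(0, 0), h⟩ => absurd h (by dsimp only; omega)
  | ⟨(0, q + 2), h⟩ => absurd h (by dsimp only; omega)
  | ⟨(1, q + 1), h⟩ => absurd h (by dsimp only; omega)
  | ⟨(p + 2, q), h⟩ => absurd h (by dsimp only; omega)

/-- The infinitesimal `θ_1 = (ρ_1, π_1)`. -/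
def infinitesimal (R : Series K A (H ⊗[K] A)) (P : Series K (A ⊗[K] A) A) : Tot K H A 2 :=
  pairCochain (R 1) (P 1)

end Deformation

end

end ComoduleAlgebraDeformation

/-! Both differentials are alternating sums of coface maps satisfying the cosimplicial identities,
so their squares cancel in pairs (`altSum_comp_altSum`). In the Hochschild direction the identities
come from associativity of `A` and the bimodule axioms of `H^{⊗ q} ⊗ A`; in the vertical direction,
from coassociativity of `Δ`, of `ρ` and of the diagonal coaction. The two directions commute: every
vertical coface except the one built from the diagonal coaction is postcomposition with a bimodule
map, because `Δ` and `ρ` are multiplicative and coassociative, and the exceptional one is handled by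
`hochschildD_coactFirst`. The sign `(-1)^{p+1}` then turns commuting into anticommuting.

If the coefficients of a deformation vanish strictly between degrees `0` and `n`, the `t^n`
coefficients of the three axioms are linear in `(ρ_n, π_n)` and are exactly the three components of
the 2-cocycle condition (`IsDeformation.pairCochain_mem_cocycles`). For `n = 1` this is the claim
about infinitesimals. Since `C^1 = Der(A)` and `d` kills derivations, the 2-coboundaries are the
pairs `(ρφ - (Id ⊗ φ)ρ, 0)` with `φ` a derivation. Conjugation by a formal automorphism, whose `φ_1`
is a derivation, changes the infinitesimal by such a pair.

For rigidity, a series `Φ` is sought with `R ∘ Φ = (Id ⊗ Φ) ∘ ρ` and `P ∘ (Φ ⊗ Φ) = Φ ∘ μ_A`. If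
both equations hold modulo `t^n`, the `t^n` coefficients of their defects form a 2-cocycle, being
also the `t^n` coefficients of the deformation conjugated by `Φ`. When `H^2 = 0` it is the
coboundary of a derivation `φ`, and `Φ - φ t^n` solves the equations modulo `t^{n+1}`. Correcting
additively, rather than by an infinite product of automorphisms, means that each coefficient changes
at one stage only, so the limit exists trivially. -/

namespace ComoduleAlgebraDeformation

/-! ### Alternating sums of coface maps. -/

section Sums

variable {K : Type*} [CommSemiring K] {X Y Z W : Type*} [AddCommMonoid X] [Module K X]
  [AddCommMonoid Y] [Module K Y] [AddCommMonoid Z] [Module K Z] [AddCommMonoid W] [Module K W]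
  {ι : Type*} (s : Finset ι)

theorem sum_comp (f : ι → (Y →ₗ[K] Z)) (g : X →ₗ[K] Y) :
    (∑ i ∈ s, f i) ∘ₗ g = ∑ i ∈ s, f i ∘ₗ g := by
  ext x; simp

theorem comp_sum (f : Y →ₗ[K] Z) (g : ι → (X →ₗ[K] Y)) :
    f ∘ₗ (∑ i ∈ s, g i) = ∑ i ∈ s, f ∘ₗ g i := by
  ext x; simp

theorem map_sum_right (f : X →ₗ[K] Y) (g : ι → (Z →ₗ[K] W)) :
    TensorProduct.map f (∑ i ∈ s, g i) = ∑ i ∈ s, TensorProduct.map f (g i) :=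
  map_sum (TensorProduct.mapBilinear (RingHom.id K) X Z Y W f) g s

theorem map_sum_left (f : ι → (X →ₗ[K] Y)) (g : Z →ₗ[K] W) :
    TensorProduct.map (∑ i ∈ s, f i) g = ∑ i ∈ s, TensorProduct.map (f i) g :=
  (map_sum ((TensorProduct.mapBilinear (RingHom.id K) X Z Y W).flip g) f s)

end Sums

/-- The index pairs `(k + 1, i)` and `(i, k)` with `i ≤ k` carry the same value with opposite signs,
and every index pair has exactly one of these two forms. Exchanging them is a fixed-point-free
involution. -/
theorem sum_alternating_coface_eq_zero {M : Type*} [AddCommGroup M] {m : ℕ}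
    (F : Fin (m + 1) → Fin m → M) (h : ∀ i k : Fin m, i ≤ k → F k.succ i = F i.castSucc k) :
    ∑ j : Fin (m + 1), ∑ i : Fin m, (-1 : ℤ) ^ ((j : ℕ) + (i : ℕ)) • F j i = 0 := by
  rw [← Finset.sum_product']
  let g : Fin (m + 1) × Fin m → Fin (m + 1) × Fin m := fun x =>
    if hx : x.2.castSucc < x.1 then
      (x.2.castSucc, x.1.pred (Fin.ne_zero_of_lt hx))
    else (x.2.succ, x.1.castPred (by
      have := x.2.2; intro h; simp only [Fin.ext_iff, Fin.lt_def] at hx h; simp at hx h; omega))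
  have key : ∀ i k : Fin m, i ≤ k →
      (-1 : ℤ) ^ ((k.succ : ℕ) + (i : ℕ)) • F k.succ i
        + (-1 : ℤ) ^ ((i.castSucc : ℕ) + (k : ℕ)) • F i.castSucc k = 0 := by
    intro i k hik
    rw [h i k hik, ← add_smul]
    have : (-1 : ℤ) ^ ((k.succ : ℕ) + (i : ℕ)) + (-1 : ℤ) ^ ((i.castSucc : ℕ) + (k : ℕ)) = 0 := by
      simp only [Fin.val_succ, Fin.val_castSucc]; ring
    rw [this, zero_smul]
  have lower : ∀ i k : Fin m, i ≤ k → g (k.succ, i) = (i.castSucc, k) := by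
    intro i k hik
    have : i.castSucc < k.succ := Fin.castSucc_lt_succ_iff.mpr hik
    simp [g, this]
  have upper : ∀ i k : Fin m, i ≤ k → g (i.castSucc, k) = (k.succ, i) := by
    intro i k hik
    have : ¬ k.castSucc < i.castSucc := by simpa using hik
    simp [g, hik]
  have cases : ∀ x : Fin (m + 1) × Fin m, ∃ i k : Fin m, i ≤ k ∧
      (x = (k.succ, i) ∨ x = (i.castSucc, k)) := by
    rintro ⟨j, i⟩
    by_cases hx : i.castSucc < j
    · obtain ⟨k, rfl⟩ := Fin.exists_succ_eq.mpr (Fin.ne_zero_of_lt hx)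
      exact ⟨i, k, Fin.castSucc_lt_succ_iff.mp hx, Or.inl rfl⟩
    · have hj : j ≠ Fin.last m := by
        rintro rfl; exact hx (Fin.castSucc_lt_last i)
      obtain ⟨k, rfl⟩ := Fin.exists_castSucc_eq.mpr hj
      exact ⟨k, i, by simpa using hx, Or.inr rfl⟩
  refine Finset.sum_involution (fun x _ => g x) ?_ ?_ (fun _ _ => by simp) ?_
  · intro x _
    obtain ⟨i, k, hik, rfl | rfl⟩ := cases x
    · rw [lower i k hik]; exact key i k hik
    · rw [upper i k hik, add_comm]; exact key i k hik
  · intro x _ _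
    obtain ⟨i, k, hik, rfl | rfl⟩ := cases x
    · rw [lower i k hik]; intro h
      have := congrArg (fun y => (y.2 : ℕ)) h
      have h1 := congrArg (fun y => (y.1 : ℕ)) h
      simp at this h1; omega
    · rw [upper i k hik]; intro h
      have := congrArg (fun y => (y.2 : ℕ)) h
      have h1 := congrArg (fun y => (y.1 : ℕ)) h
      simp at this h1; omega
  · intro x _
    obtain ⟨i, k, hik, rfl | rfl⟩ := cases x
    · rw [lower i k hik, upper i k hik]
    · rw [upper i k hik, lower i k hik]

/-- The alternating sum of a family of coface maps, given by a first map `a`, intermediate maps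
`m i`, and a last map `z`. -/
def altSum {K X Y : Type*} [Field K] [AddCommGroup X] [Module K X] [AddCommGroup Y] [Module K Y]
    {n : ℕ} (a : X →ₗ[K] Y) (m : Fin n → (X →ₗ[K] Y)) (z : X →ₗ[K] Y) : X →ₗ[K] Y :=
  a + ∑ i : Fin n, (-1 : K) ^ ((i : ℕ) + 1) • m i + (-1 : K) ^ (n + 1) • z

theorem altSum_eq_sum {K X Y : Type*} [Field K] [AddCommGroup X] [Module K X] [AddCommGroup Y]
    [Module K Y] {n : ℕ} (a : X →ₗ[K] Y) (m : Fin n → (X →ₗ[K] Y)) (z : X →ₗ[K] Y) :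
    altSum a m z = ∑ i : Fin (n + 2), (-1 : ℤ) ^ (i : ℕ) •
      (Fin.cons a (Fin.snoc m z : Fin (n + 1) → (X →ₗ[K] Y)) : Fin (n + 2) → (X →ₗ[K] Y)) i := by
  have e : ∀ (k : ℕ) (f : X →ₗ[K] Y), (-1 : ℤ) ^ k • f = (-1 : K) ^ k • f := by
    intro k f
    rcases neg_one_pow_eq_or ℤ k with h | h <;> rcases Nat.even_or_odd k with h' | h' <;>
      simp [h'.neg_one_pow]
  rw [Fin.sum_univ_succ, Fin.sum_univ_castSucc]
  simp [altSum, e, add_assoc]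

/-- The hypotheses are the cosimplicial identities `d^{k+1} d^i = d^i d^k` for `i ≤ k`, sorted by
whether the indices meet the first, an intermediate or the last coface. Both complexes define these
three kinds of coface by different formulas. -/
theorem altSum_comp_altSum {K X Y Z : Type*} [Field K] [AddCommGroup X] [Module K X]
    [AddCommGroup Y] [Module K Y] [AddCommGroup Z] [Module K Z] {n : ℕ}
    (a₁ : X →ₗ[K] Y) (m₁ : Fin n → (X →ₗ[K] Y)) (z₁ : X →ₗ[K] Y)
    (a₂ : Y →ₗ[K] Z) (m₂ : Fin (n + 1) → (Y →ₗ[K] Z)) (z₂ : Y →ₗ[K] Z)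
    (haa : m₂ 0 ∘ₗ a₁ = a₂ ∘ₗ a₁) (ham : ∀ k, m₂ k.succ ∘ₗ a₁ = a₂ ∘ₗ m₁ k)
    (haz : z₂ ∘ₗ a₁ = a₂ ∘ₗ z₁)
    (hmm : ∀ i k, i ≤ k → m₂ k.succ ∘ₗ m₁ i = m₂ i.castSucc ∘ₗ m₁ k)
    (hmz : ∀ i, z₂ ∘ₗ m₁ i = m₂ i.castSucc ∘ₗ z₁)
    (hzz : z₂ ∘ₗ z₁ = m₂ (Fin.last n) ∘ₗ z₁) :
    altSum a₂ m₂ z₂ ∘ₗ altSum a₁ m₁ z₁ = 0 := by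
  let G₁ : Fin (n + 2) → (X →ₗ[K] Y) := Fin.cons a₁ (Fin.snoc m₁ z₁ : Fin (n + 1) → _)
  let G₂ : Fin (n + 3) → (Y →ₗ[K] Z) := Fin.cons a₂ (Fin.snoc m₂ z₂ : Fin (n + 2) → _)
  have c₁ (i) : G₁ (Fin.succ (Fin.castSucc i)) = m₁ i := Fin.snoc_castSucc (α := fun _ => X →ₗ[K] Y) ..
  have c₂ (i) : G₂ (Fin.succ (Fin.castSucc i)) = m₂ i := Fin.snoc_castSucc (α := fun _ => Y →ₗ[K] Z) ..
  have l₁ : G₁ (Fin.succ (Fin.last n)) = z₁ := Fin.snoc_last (α := fun _ => X →ₗ[K] Y) ..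
  have l₂ : G₂ (Fin.succ (Fin.last (n + 1))) = z₂ := Fin.snoc_last (α := fun _ => Y →ₗ[K] Z) ..
  rw [altSum_eq_sum, altSum_eq_sum, ← sum_alternating_coface_eq_zero
    (fun (j : Fin (n + 3)) (i : Fin (n + 2)) => G₂ j ∘ₗ G₁ i)]
  · rw [sum_comp]
    refine Finset.sum_congr rfl fun j _ => ?_
    rw [comp_sum]
    refine Finset.sum_congr rfl fun i _ => ?_
    rw [LinearMap.comp_smul, LinearMap.smul_comp, smul_smul, pow_add, mul_comm]
  · intro i k hik
    cases i using Fin.cases with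
    | zero =>
      cases k using Fin.cases with
      | zero => exact (congrArg (· ∘ₗ a₁) (c₂ 0)).trans haa
      | succ k =>
        cases k using Fin.lastCases with
        | last =>
          change G₂ (Fin.succ (Fin.last (n + 1))) ∘ₗ a₁ = a₂ ∘ₗ G₁ (Fin.succ (Fin.last n))
          rw [l₁, l₂, haz]
        | cast k =>
          change G₂ (Fin.succ (Fin.castSucc k.succ)) ∘ₗ a₁ = a₂ ∘ₗ G₁ (Fin.succ (Fin.castSucc k))
          rw [c₁, c₂, ham]
    | succ i =>
      cases k using Fin.cases with
      | zero => exact absurd hik (by simp)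
      | succ k =>
        rw [Fin.succ_le_succ_iff] at hik
        cases i using Fin.lastCases with
        | last =>
          obtain rfl : k = Fin.last n := Fin.last_le_iff.mp hik
          change G₂ (Fin.succ (Fin.last (n + 1))) ∘ₗ _ = G₂ (Fin.succ (Fin.castSucc (Fin.last n))) ∘ₗ _
          rw [l₁, l₂, c₂, hzz]
        | cast i =>
          cases k using Fin.lastCases with
          | last =>
            change G₂ (Fin.succ (Fin.last (n + 1))) ∘ₗ _ =
              G₂ (Fin.succ (Fin.castSucc (Fin.castSucc i))) ∘ₗ _
            rw [l₁, l₂, c₁, c₂, hmz]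
          | cast k =>
            change G₂ (Fin.succ (Fin.castSucc k.succ)) ∘ₗ _ =
              G₂ (Fin.succ (Fin.castSucc (Fin.castSucc i))) ∘ₗ _
            rw [c₁, c₁, c₂, c₂, hmm i k (Fin.castSucc_le_castSucc_iff.mp hik)]

/-! ### The Hochschild coboundary squares to zero. -/

section Hochschild

variable {K : Type w} [Field K] {A M N : Type u}
  [NonUnitalRing A] [Module K A] [IsScalarTower K A A] [SMulCommClass K A A]
  [AddCommGroup M] [Module K M] [AddCommGroup N] [Module K N]

/-- For `i = k` this is associativity; for `i < k` the two products involve disjoint pairs of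
factors. The induction strips common leading factors. -/
theorem mulAt_mulAt (n : ℕ) (i k : Fin (n + 1)) (h : i ≤ k) :
    mulAt K A n i ∘ₗ mulAt K A (n + 1) k.succ = mulAt K A n k ∘ₗ mulAt K A (n + 1) i.castSucc := by
  induction n with
  | zero =>
    fin_cases i
    fin_cases k
    refine TensorProduct.ext' fun a x => ?_
    induction x using TensorProduct.induction_on with
    | zero => simp
    | add x y hx hy => rw [TensorProduct.tmul_add, map_add, map_add, hx, hy]
    | tmul b c => exact (mul_assoc a b c).symm
  | succ n ih =>
    cases i using Fin.cases with
    | zero =>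
      cases k using Fin.cases with
      | zero =>
        refine TensorProduct.ext' fun a x => ?_
        induction x using TensorProduct.induction_on with
        | zero => simp
        | add x y hx hy => rw [TensorProduct.tmul_add, map_add, map_add, hx, hy]
        | tmul b x =>
          induction x using TensorProduct.induction_on with
          | zero => simp
          | add x y hx hy =>
            rw [TensorProduct.tmul_add, TensorProduct.tmul_add, map_add, map_add, hx, hy]
          | tmul c x => exact congrArg (· ⊗ₜ[K] x) (mul_assoc a b c).symm
      | succ k =>
        refine TensorProduct.ext' fun a x => ?_
        induction x using TensorProduct.induction_on with
        | zero => simp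
        | add x y hx hy => rw [TensorProduct.tmul_add, map_add, map_add, hx, hy]
        | tmul b x => rfl
    | succ i =>
      cases k using Fin.cases with
      | zero => exact absurd h (by simp)
      | succ k =>
        refine TensorProduct.ext' fun a x => ?_
        exact congrArg (a ⊗ₜ[K] ·)
          (LinearMap.congr_fun (ih i k (Fin.succ_le_succ_iff.mp h)) x)

theorem splitLast_mulAt (n : ℕ) (i : Fin (n + 1)) :
    splitLast K A n ∘ₗ mulAt K A (n + 1) i.castSucc =
      (mulAt K A n i).rTensor A ∘ₗ splitLast K A (n + 1) := by
  induction n with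
  | zero =>
    fin_cases i
    refine TensorProduct.ext' fun a x => ?_
    induction x using TensorProduct.induction_on with
    | zero => simp
    | add x y hx hy => rw [TensorProduct.tmul_add, map_add, map_add, hx, hy]
    | tmul b c => rfl
  | succ n ih =>
    cases i using Fin.cases with
    | zero =>
      refine TensorProduct.ext' fun a x => ?_
      induction x using TensorProduct.induction_on with
      | zero => simp
      | add x y hx hy => rw [TensorProduct.tmul_add, map_add, map_add, hx, hy]
      | tmul b x =>
        -- `splitLast K A n x` is not a pure tensor. The identity is therefore proved as an equality
        -- of linear maps, where pure tensors suffice, and then evaluated; the later `key` lemmas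
        -- treat `Δ h` and `ρ a` in the same way.
        have key : (TensorProduct.assoc K A (Tower K A A n) A).symm.toLinearMap ∘ₗ
            TensorProduct.mk K A (Tower K A A n ⊗[K] A) (a * b) =
            (mulAt K A (n + 1) 0).rTensor A ∘ₗ
              (TensorProduct.assoc K A (Tower K A A (n + 1)) A).symm.toLinearMap ∘ₗ
                TensorProduct.mk K A (Tower K A A (n + 1) ⊗[K] A) a ∘ₗ
                  (TensorProduct.assoc K A (Tower K A A n) A).symm.toLinearMap ∘ₗ
                    TensorProduct.mk K A (Tower K A A n ⊗[K] A) b :=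
          TensorProduct.ext' fun y c => rfl
        exact LinearMap.congr_fun key (splitLast K A n x)
    | succ i =>
      refine TensorProduct.ext' fun a x => ?_
      have key : (TensorProduct.assoc K A (Tower K A A n) A).symm.toLinearMap ∘ₗ
          TensorProduct.mk K A (Tower K A A n ⊗[K] A) a ∘ₗ (mulAt K A n i).rTensor A =
          (mulAt K A (n + 1) i.succ).rTensor A ∘ₗ
            (TensorProduct.assoc K A (Tower K A A (n + 1)) A).symm.toLinearMap ∘ₗ
              TensorProduct.mk K A (Tower K A A (n + 1) ⊗[K] A) a :=
        TensorProduct.ext' fun y c => rfl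
      exact (congrArg (fun y => (TensorProduct.assoc K A (Tower K A A n) A).symm (a ⊗ₜ[K] y))
        (LinearMap.congr_fun (ih i) x)).trans
          (LinearMap.congr_fun key (splitLast K A (n + 1) x))

/-- This is the position not covered by `splitLast_mulAt`: the product takes place inside the factor
being split off. -/
theorem splitLast_mulAt_last (n : ℕ) :
    splitLast K A n ∘ₗ mulAt K A (n + 1) (Fin.last (n + 1)) =
      (LinearMap.mul' K A).lTensor (Tower K A A n) ∘ₗ
        (TensorProduct.assoc K (Tower K A A n) A A).toLinearMap ∘ₗ
          (splitLast K A n).rTensor A ∘ₗ splitLast K A (n + 1) := by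
  induction n with
  | zero =>
    refine TensorProduct.ext' fun a x => ?_
    induction x using TensorProduct.induction_on with
    | zero => simp
    | add x y hx hy => rw [TensorProduct.tmul_add, map_add, map_add, hx, hy]
    | tmul b c => rfl
  | succ n ih =>
    refine TensorProduct.ext' fun a x => ?_
    have key : (TensorProduct.assoc K A (Tower K A A n) A).symm.toLinearMap ∘ₗ
        TensorProduct.mk K A (Tower K A A n ⊗[K] A) a ∘ₗ
          (LinearMap.mul' K A).lTensor (Tower K A A n) ∘ₗ
            (TensorProduct.assoc K (Tower K A A n) A A).toLinearMap ∘ₗ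
              (splitLast K A n).rTensor A =
        (LinearMap.mul' K A).lTensor (Tower K A A (n + 1)) ∘ₗ
          (TensorProduct.assoc K (Tower K A A (n + 1)) A A).toLinearMap ∘ₗ
            (splitLast K A (n + 1)).rTensor A ∘ₗ
              (TensorProduct.assoc K A (Tower K A A (n + 1)) A).symm.toLinearMap ∘ₗ
                TensorProduct.mk K A (Tower K A A (n + 1) ⊗[K] A) a := by
      refine TensorProduct.ext' fun y c => ?_
      have key' : (TensorProduct.assoc K A (Tower K A A n) A).symm.toLinearMap ∘ₗ
          TensorProduct.mk K A (Tower K A A n ⊗[K] A) a ∘ₗ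
            (LinearMap.mul' K A).lTensor (Tower K A A n) ∘ₗ
              (TensorProduct.assoc K (Tower K A A n) A A).toLinearMap ∘ₗ
                (TensorProduct.mk K (Tower K A A n ⊗[K] A) A).flip c =
          (LinearMap.mul' K A).lTensor (Tower K A A (n + 1)) ∘ₗ
            (TensorProduct.assoc K (Tower K A A (n + 1)) A A).toLinearMap ∘ₗ
              (TensorProduct.mk K (Tower K A A (n + 1) ⊗[K] A) A).flip c ∘ₗ
                (TensorProduct.assoc K A (Tower K A A n) A).symm.toLinearMap ∘ₗ
                  TensorProduct.mk K A (Tower K A A n ⊗[K] A) a :=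
        TensorProduct.ext' fun y c => rfl
      exact LinearMap.congr_fun key' (splitLast K A n y)
    exact (congrArg (fun y => (TensorProduct.assoc K A (Tower K A A n) A).symm (a ⊗ₜ[K] y))
      (LinearMap.congr_fun ih x)).trans
        (LinearMap.congr_fun key (splitLast K A (n + 1) x))

/-- The first Hochschild coface map. -/
def hochschildFirst (l : A ⊗[K] M →ₗ[K] M) (n : ℕ) :
    (Tower K A A n →ₗ[K] M) →ₗ[K] (Tower K A A (n + 1) →ₗ[K] M) :=
  LinearMap.llcomp K _ _ _ l ∘ₗ LinearMap.lTensorHom A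

/-- The intermediate Hochschild coface maps. -/
def hochschildMid (M : Type u) [AddCommGroup M] [Module K M] (n : ℕ) (i : Fin (n + 1)) :
    (Tower K A A n →ₗ[K] M) →ₗ[K] (Tower K A A (n + 1) →ₗ[K] M) :=
  LinearMap.lcomp K M (mulAt K A n i)

/-- The last Hochschild coface map. -/
def hochschildLast (r : M ⊗[K] A →ₗ[K] M) (n : ℕ) :
    (Tower K A A n →ₗ[K] M) →ₗ[K] (Tower K A A (n + 1) →ₗ[K] M) :=
  LinearMap.lcomp K M (splitLast K A n) ∘ₗ LinearMap.llcomp K _ _ _ r ∘ₗ LinearMap.rTensorHom A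

theorem hochschildD_eq_altSum (l : A ⊗[K] M →ₗ[K] M) (r : M ⊗[K] A →ₗ[K] M) (n : ℕ) :
    hochschildD l r n =
      altSum (hochschildFirst l n) (hochschildMid M n) (hochschildLast r n) := by
  ext1 φ
  simp only [altSum, LinearMap.add_apply, LinearMap.sum_apply, LinearMap.smul_apply]
  rfl

/-- The three bimodule axioms settle the first-first, last-last and first-last identities; the
others are properties of `mulAt` and `splitLast` alone. -/
theorem hochschildD_comp_hochschildD (l : A ⊗[K] M →ₗ[K] M) (r : M ⊗[K] A →ₗ[K] M)
    (hl : ∀ a b m, l (a ⊗ₜ l (b ⊗ₜ m)) = l ((a * b) ⊗ₜ m))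
    (hr : ∀ m a b, r (r (m ⊗ₜ a) ⊗ₜ b) = r (m ⊗ₜ (a * b)))
    (hlr : ∀ a m b, r (l (a ⊗ₜ m) ⊗ₜ b) = l (a ⊗ₜ r (m ⊗ₜ b))) (n : ℕ) :
    hochschildD l r (n + 1) ∘ₗ hochschildD l r n = 0 := by
  rw [hochschildD_eq_altSum, hochschildD_eq_altSum]
  apply altSum_comp_altSum
  · ext1 φ
    refine TensorProduct.ext' fun a x => ?_
    induction x using TensorProduct.induction_on with
    | zero => simp
    | add x y hx hy => rw [TensorProduct.tmul_add, map_add, map_add, hx, hy]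
    | tmul b x => exact (hl a b (φ x)).symm
  · intro k
    ext1 φ
    exact TensorProduct.ext' fun a x => rfl
  · ext1 φ
    refine TensorProduct.ext' fun a x => ?_
    have key : r ∘ₗ (l ∘ₗ φ.lTensor A).rTensor A ∘ₗ
        (TensorProduct.assoc K A (Tower K A A n) A).symm.toLinearMap ∘ₗ
          TensorProduct.mk K A (Tower K A A n ⊗[K] A) a =
        l ∘ₗ TensorProduct.mk K A M a ∘ₗ r ∘ₗ φ.rTensor A :=
      TensorProduct.ext' fun x b => hlr a (φ x) b
    exact LinearMap.congr_fun key (splitLast K A n x)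
  · intro i k h
    ext1 φ
    exact congrArg (φ ∘ₗ ·) (mulAt_mulAt n i k h)
  · intro i
    ext1 φ
    change r ∘ₗ (φ ∘ₗ mulAt K A n i).rTensor A ∘ₗ splitLast K A (n + 1) =
      r ∘ₗ φ.rTensor A ∘ₗ (splitLast K A n ∘ₗ mulAt K A (n + 1) i.castSucc)
    rw [splitLast_mulAt, LinearMap.rTensor_comp, LinearMap.comp_assoc]
  · ext1 φ
    change r ∘ₗ (r ∘ₗ φ.rTensor A ∘ₗ splitLast K A n).rTensor A ∘ₗ splitLast K A (n + 1) =
      r ∘ₗ φ.rTensor A ∘ₗ (splitLast K A n ∘ₗ mulAt K A (n + 1) (Fin.last (n + 1)))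
    rw [splitLast_mulAt_last, LinearMap.rTensor_comp, LinearMap.rTensor_comp]
    simp only [← LinearMap.comp_assoc]
    congr 2
    refine TensorProduct.ext' fun x b => ?_
    induction x using TensorProduct.induction_on with
    | zero => simp
    | add x y hx hy => rw [TensorProduct.add_tmul, map_add, map_add, hx, hy]
    | tmul x a => exact hr (φ x) a b

/-- Postcomposition with a morphism of bimodules commutes with the Hochschild coboundary. -/
theorem hochschildD_comp (l : A ⊗[K] M →ₗ[K] M) (r : M ⊗[K] A →ₗ[K] M)
    (l' : A ⊗[K] N →ₗ[K] N) (r' : N ⊗[K] A →ₗ[K] N) (f : M →ₗ[K] N)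
    (hl : f ∘ₗ l = l' ∘ₗ f.lTensor A) (hr : f ∘ₗ r = r' ∘ₗ f.rTensor A) (n : ℕ)
    (φ : Tower K A A n →ₗ[K] M) :
    hochschildD l' r' n (f ∘ₗ φ) = f ∘ₗ hochschildD l r n φ := by
  change l' ∘ₗ (f ∘ₗ φ).lTensor A
      + ∑ i : Fin (n + 1), (-1 : K) ^ ((i : ℕ) + 1) • ((f ∘ₗ φ) ∘ₗ mulAt K A n i)
      + (-1 : K) ^ (n + 2) • (r' ∘ₗ (f ∘ₗ φ).rTensor A ∘ₗ splitLast K A n) =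
    f ∘ₗ (l ∘ₗ φ.lTensor A
      + ∑ i : Fin (n + 1), (-1 : K) ^ ((i : ℕ) + 1) • (φ ∘ₗ mulAt K A n i)
      + (-1 : K) ^ (n + 2) • (r ∘ₗ φ.rTensor A ∘ₗ splitLast K A n))
  simp only [LinearMap.comp_add, comp_sum, LinearMap.comp_smul, LinearMap.lTensor_comp,
    LinearMap.rTensor_comp]
  simp only [← LinearMap.comp_assoc, hl, hr]

end Hochschild

/-! ### The bimodules `H^{⊗ q} ⊗ A` and the maps between them. -/

section Coaction

variable {K : Type w} [Field K] {H A : Type u}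
  [NonUnitalRing H] [Module K H] [IsScalarTower K H H] [SMulCommClass K H H]
  [NonUnitalRing A] [Module K A] [IsScalarTower K A A] [SMulCommClass K A A]

variable (K H A) in
theorem towerMul_assoc (q : ℕ) (x y z : Tower K H A q) :
    towerMul K H A q (towerMul K H A q (x ⊗ₜ y) ⊗ₜ z) =
      towerMul K H A q (x ⊗ₜ towerMul K H A q (y ⊗ₜ z)) := by
  induction q with
  | zero => exact mul_assoc (G := A) x y z
  | succ q ih =>
    let B := (TensorProduct.mk K (Tower K H A (q + 1)) (Tower K H A (q + 1))).compr₂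
      (towerMul K H A (q + 1))
    -- Stating associativity as an equality of maps linear in the first argument allows
    -- extensionality to reduce that argument to a pure tensor.
    have key : B.compr₂ B = (LinearMap.llcomp K _ _ _).flip B ∘ₗ LinearMap.llcomp K _ _ _ ∘ₗ B := by
      refine TensorProduct.ext' fun h x => ?_
      refine LinearMap.ext fun y => LinearMap.ext fun z => ?_
      revert y z
      suffices ∀ y z, B (B (h ⊗ₜ x) y) z = B (h ⊗ₜ x) (B y z) from this
      intro y z
      induction y using TensorProduct.induction_on with
      | zero => simp
      | add y y' hy hy' => rw [map_add, map_add, map_add, LinearMap.add_apply, LinearMap.add_apply, map_add, hy, hy']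
      | tmul k y =>
        induction z using TensorProduct.induction_on with
        | zero => simp
        | add y y' hy hy' => rw [map_add, map_add, map_add, hy, hy']
        | tmul j z =>
          exact congrArg₂ (· ⊗ₜ[K] ·) (mul_assoc h k j) (ih x y z)
    exact LinearMap.congr_fun (LinearMap.congr_fun (LinearMap.congr_fun key x) y) z

/-- Induction step for multiplicativity: it survives an extra factor `H` on the left. -/
theorem lTensor_comp_towerMul {q q' : ℕ} (f : Tower K H A q →ₗ[K] Tower K H A q')
    (hf : f ∘ₗ towerMul K H A q = towerMul K H A q' ∘ₗ TensorProduct.map f f) :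
    f.lTensor H ∘ₗ towerMul K H A (q + 1) =
      towerMul K H A (q' + 1) ∘ₗ TensorProduct.map (f.lTensor H) (f.lTensor H) :=
  TensorProduct.ext_fourfold' fun h x k y =>
    congrArg ((h * k) ⊗ₜ[K] ·) (LinearMap.congr_fun hf (x ⊗ₜ y))

section

variable {Δ : H →ₗ[K] H ⊗[K] H} {ρ : A →ₗ[K] H ⊗[K] A}

theorem coactLast_comp_towerMul (hρ : IsComoduleAlgebra Δ ρ) (q : ℕ) :
    coactLast ρ q ∘ₗ towerMul K H A q =
      towerMul K H A (q + 1) ∘ₗ TensorProduct.map (coactLast ρ q) (coactLast ρ q) := by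
  induction q with
  | zero => exact hρ.coact_mul
  | succ q ih => exact lTensor_comp_towerMul _ ih

theorem comulAt_comp_towerMul (hΔ : IsBialgebra Δ) (q : ℕ) (i : Fin q) :
    comulAt A Δ q i ∘ₗ towerMul K H A q =
      towerMul K H A (q + 1) ∘ₗ TensorProduct.map (comulAt A Δ q i) (comulAt A Δ q i) := by
  induction q with
  | zero => exact i.elim0
  | succ q ih =>
    cases i using Fin.cases with
    | zero =>
      refine TensorProduct.ext_fourfold' fun h x k y => ?_
      have key : (TensorProduct.assoc K H H (Tower K H A q)).toLinearMap ∘ₗ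
          (TensorProduct.mk K (H ⊗[K] H) (Tower K H A q)).flip (towerMul K H A q (x ⊗ₜ y)) ∘ₗ
            TensorProduct.map (LinearMap.mul' K H) (LinearMap.mul' K H) ∘ₗ
              (TensorProduct.tensorTensorTensorComm K H H H H).toLinearMap =
          towerMul K H A (q + 2) ∘ₗ TensorProduct.map
            ((TensorProduct.assoc K H H (Tower K H A q)).toLinearMap ∘ₗ
              (TensorProduct.mk K (H ⊗[K] H) (Tower K H A q)).flip x)
            ((TensorProduct.assoc K H H (Tower K H A q)).toLinearMap ∘ₗ
              (TensorProduct.mk K (H ⊗[K] H) (Tower K H A q)).flip y) :=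
        TensorProduct.ext_fourfold' fun a b c d => rfl
      exact (congrArg (fun z => TensorProduct.assoc K H H (Tower K H A q)
        (z ⊗ₜ towerMul K H A q (x ⊗ₜ y))) (LinearMap.congr_fun hΔ.comul_mul (h ⊗ₜ k))).trans
          (LinearMap.congr_fun key (Δ h ⊗ₜ Δ k))
    | succ i => exact lTensor_comp_towerMul _ (ih i)

/-- The definition iterates `Δ` on the `H` factor; coassociativity of `ρ` replaces this by iterating
`ρ`, a form suited to induction. -/
theorem coactIter_succ (hρ : IsComoduleAlgebra Δ ρ) (q : ℕ) :
    coactIter Δ ρ (q + 1) = (coactIter Δ ρ q).lTensor H ∘ₗ ρ := by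
  cases q with
  | zero => exact congrArg (· ∘ₗ ρ) (LinearMap.lTensor_id H A).symm
  | succ q =>
    change (comulIter A Δ q).lTensor H ∘ₗ ((TensorProduct.assoc K H H A).toLinearMap ∘ₗ
      Δ.rTensor A ∘ₗ ρ) = (comulIter A Δ q ∘ₗ ρ).lTensor H ∘ₗ ρ
    rw [← hρ.coassoc, LinearMap.lTensor_comp, LinearMap.comp_assoc]

theorem coactLast_comp_coactIter (hρ : IsComoduleAlgebra Δ ρ) (q : ℕ) :
    coactLast ρ q ∘ₗ coactIter Δ ρ q = coactIter Δ ρ (q + 1) := by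
  induction q with
  | zero => rfl
  | succ q ih =>
    rw [coactIter_succ hρ (q + 1)]
    conv_rhs => rw [← ih, LinearMap.lTensor_comp, LinearMap.comp_assoc]
    rw [coactIter_succ hρ q]
    rfl

/-- As for `coactLast`, every way of lengthening the iterated coaction by one factor gives the same
result, by coassociativity. -/
theorem comulAt_comp_coactIter (hρ : IsComoduleAlgebra Δ ρ) (q : ℕ) (i : Fin q) :
    comulAt A Δ q i ∘ₗ coactIter Δ ρ q = coactIter Δ ρ (q + 1) := by
  induction q with
  | zero => exact i.elim0
  | succ q ih =>
    cases i using Fin.cases with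
    | zero =>
      rw [coactIter_succ hρ (q + 1), coactIter_succ hρ q, LinearMap.lTensor_comp,
        LinearMap.comp_assoc, hρ.coassoc, ← LinearMap.comp_assoc, ← LinearMap.comp_assoc,
        ← LinearMap.comp_assoc]
      congr 1
      refine TensorProduct.ext' fun h a => ?_
      have key : (TensorProduct.assoc K H H (Tower K H A q)).toLinearMap ∘ₗ
          (TensorProduct.mk K (H ⊗[K] H) (Tower K H A q)).flip (coactIter Δ ρ q a) =
          ((coactIter Δ ρ q).lTensor H).lTensor H ∘ₗ (TensorProduct.assoc K H H A).toLinearMap ∘ₗ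
            (TensorProduct.mk K (H ⊗[K] H) A).flip a :=
        TensorProduct.ext' fun h k => rfl
      exact LinearMap.congr_fun key (Δ h)
    | succ i =>
      rw [coactIter_succ hρ (q + 1)]
      conv_rhs => rw [← ih i, LinearMap.lTensor_comp, LinearMap.comp_assoc]
      rw [coactIter_succ hρ q]
      rfl

theorem coactIter_comp_mul (hρ : IsComoduleAlgebra Δ ρ) (q : ℕ) :
    coactIter Δ ρ q ∘ₗ LinearMap.mul' K A =
      towerMul K H A q ∘ₗ TensorProduct.map (coactIter Δ ρ q) (coactIter Δ ρ q) := by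
  induction q with
  | zero => rw [coactIter, TensorProduct.map_id]; rfl
  | succ q ih =>
    rw [← coactLast_comp_coactIter hρ, LinearMap.comp_assoc, ih, ← LinearMap.comp_assoc,
      coactLast_comp_towerMul hρ, TensorProduct.map_comp, LinearMap.comp_assoc]

/-- An element `a` acts as multiplication by its iterated coaction, so a multiplicative map
preserving iterated coactions respects the action. -/
theorem comp_leftAct {q q' : ℕ} (f : Tower K H A q →ₗ[K] Tower K H A q')
    (hf : f ∘ₗ towerMul K H A q = towerMul K H A q' ∘ₗ TensorProduct.map f f)
    (hf' : f ∘ₗ coactIter Δ ρ q = coactIter Δ ρ q') :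
    f ∘ₗ leftAct Δ ρ q = leftAct Δ ρ q' ∘ₗ f.lTensor A := by
  rw [leftAct, leftAct, ← LinearMap.comp_assoc, hf, ← hf']
  exact TensorProduct.ext' fun a x => rfl

theorem comp_rightAct {q q' : ℕ} (f : Tower K H A q →ₗ[K] Tower K H A q')
    (hf : f ∘ₗ towerMul K H A q = towerMul K H A q' ∘ₗ TensorProduct.map f f)
    (hf' : f ∘ₗ coactIter Δ ρ q = coactIter Δ ρ q') :
    f ∘ₗ rightAct Δ ρ q = rightAct Δ ρ q' ∘ₗ f.rTensor A := by
  rw [rightAct, rightAct, ← LinearMap.comp_assoc, hf, ← hf']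
  exact TensorProduct.ext' fun a x => rfl

theorem coactIter_mul (hρ : IsComoduleAlgebra Δ ρ) (q : ℕ) (a b : A) :
    coactIter Δ ρ q (a * b) = towerMul K H A q (coactIter Δ ρ q a ⊗ₜ coactIter Δ ρ q b) :=
  LinearMap.congr_fun (coactIter_comp_mul hρ q) (a ⊗ₜ b)

theorem hochschildD_comp_hochschildD_act (hρ : IsComoduleAlgebra Δ ρ) (p q : ℕ) :
    hochschildD (leftAct Δ ρ q) (rightAct Δ ρ q) (p + 1) ∘ₗ
      hochschildD (leftAct Δ ρ q) (rightAct Δ ρ q) p = 0 := by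
  refine hochschildD_comp_hochschildD _ _ (fun a b m => ?_) (fun m a b => ?_)
    (fun a m b => ?_) p
  · exact (towerMul_assoc K H A q _ _ _).symm.trans
      (congrArg (fun z => towerMul K H A q (z ⊗ₜ m)) (coactIter_mul hρ q a b).symm)
  · exact (towerMul_assoc K H A q _ _ _).trans
      (congrArg (fun z => towerMul K H A q (m ⊗ₜ z)) (coactIter_mul hρ q a b).symm)
  · exact towerMul_assoc K H A q _ _ _

/-! ### The diagonal coaction -/

/-- The multiplication `(H ⊗ X) ⊗ (H ⊗ Y) → H ⊗ (X ⊗ Y)`. -/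
def mulFst (K : Type w) [Field K] (H : Type u) [NonUnitalRing H] [Module K H]
    [IsScalarTower K H H] [SMulCommClass K H H] (X Y : Type u) [AddCommGroup X] [Module K X]
    [AddCommGroup Y] [Module K Y] :
    (H ⊗[K] X) ⊗[K] (H ⊗[K] Y) →ₗ[K] H ⊗[K] (X ⊗[K] Y) :=
  (LinearMap.mul' K H).rTensor (X ⊗[K] Y) ∘ₗ
    (TensorProduct.tensorTensorTensorComm K H X H Y).toLinearMap

theorem mulFst_assoc {X Y Z : Type u} [AddCommGroup X] [Module K X] [AddCommGroup Y] [Module K Y]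
    [AddCommGroup Z] [Module K Z] (u : H ⊗[K] X) (v : H ⊗[K] Y) (w : H ⊗[K] Z) :
    (TensorProduct.assoc K X Y Z).toLinearMap.lTensor H
      (mulFst K H (X ⊗[K] Y) Z (mulFst K H X Y (u ⊗ₜ v) ⊗ₜ w)) =
    mulFst K H X (Y ⊗[K] Z) (u ⊗ₜ mulFst K H Y Z (v ⊗ₜ w)) := by
  induction u using TensorProduct.induction_on with
  | zero => simp
  | add u u' hu hu' => simp only [TensorProduct.add_tmul, map_add, hu, hu']
  | tmul h x =>
    induction v using TensorProduct.induction_on with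
    | zero => simp
    | add u u' hu hu' => simp only [TensorProduct.add_tmul, TensorProduct.tmul_add, map_add, hu, hu']
    | tmul k y =>
      induction w using TensorProduct.induction_on with
      | zero => simp
      | add u u' hu hu' => simp only [TensorProduct.tmul_add, map_add, hu, hu']
      | tmul j z => exact congrArg (· ⊗ₜ[K] _) (mul_assoc h k j)

theorem mulFst_map {X Y X' Y' : Type u} [AddCommGroup X] [Module K X] [AddCommGroup Y] [Module K Y]
    [AddCommGroup X'] [Module K X'] [AddCommGroup Y'] [Module K Y'] (f : X →ₗ[K] X')
    (g : Y →ₗ[K] Y') (u : H ⊗[K] X) (v : H ⊗[K] Y) :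
    mulFst K H X' Y' (f.lTensor H u ⊗ₜ g.lTensor H v) =
      (TensorProduct.map f g).lTensor H (mulFst K H X Y (u ⊗ₜ v)) := by
  have key : mulFst K H X' Y' ∘ₗ TensorProduct.map (f.lTensor H) (g.lTensor H) =
      (TensorProduct.map f g).lTensor H ∘ₗ mulFst K H X Y :=
    TensorProduct.ext_fourfold' fun h x k y => rfl
  exact LinearMap.congr_fun key (u ⊗ₜ v)

theorem coact_mul_apply (hρ : IsComoduleAlgebra Δ ρ) (a b : A) :
    ρ (a * b) = (LinearMap.mul' K A).lTensor H (mulFst K H A A (ρ a ⊗ₜ ρ b)) := by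
  refine (LinearMap.congr_fun hρ.coact_mul (a ⊗ₜ b)).trans ?_
  have key : TensorProduct.map (LinearMap.mul' K H) (LinearMap.mul' K A) ∘ₗ
      (TensorProduct.tensorTensorTensorComm K H A H A).toLinearMap =
      (LinearMap.mul' K A).lTensor H ∘ₗ mulFst K H A A :=
    TensorProduct.ext_fourfold' fun h x k y => rfl
  exact LinearMap.congr_fun key (ρ a ⊗ₜ ρ b)

/-- This is `ρ(ab) = ρ(a)ρ(b)` inside a longer tensor, the coefficients in `H` being regrouped by
associativity. -/
theorem coactPow_comp_mulAt (hρ : IsComoduleAlgebra Δ ρ) (p : ℕ) (i : Fin (p + 1)) :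
    coactPow ρ p ∘ₗ mulAt K A p i = (mulAt K A p i).lTensor H ∘ₗ coactPow ρ (p + 1) := by
  induction p with
  | zero => exact TensorProduct.ext' fun a b => coact_mul_apply hρ a b
  | succ p ih =>
    cases i using Fin.cases with
    | zero =>
      refine TensorProduct.ext' fun a x => ?_
      induction x using TensorProduct.induction_on with
      | zero => simp
      | add x y hx hy => rw [TensorProduct.tmul_add, map_add, map_add, hx, hy]
      | tmul b x =>
        change mulFst K H A (Tower K A A p) (ρ (a * b) ⊗ₜ coactPow ρ p x) =
          ((LinearMap.mul' K A).rTensor (Tower K A A p) ∘ₗ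
            (TensorProduct.assoc K A A (Tower K A A p)).symm.toLinearMap).lTensor H
              (mulFst K H A (A ⊗[K] Tower K A A p) (ρ a ⊗ₜ
                mulFst K H A (Tower K A A p) (ρ b ⊗ₜ coactPow ρ p x)))
        rw [← mulFst_assoc, coact_mul_apply hρ]
        -- An identity map is inserted on the second factor so that `mulFst_map` applies.
        refine (congrArg (fun z => mulFst K H A (Tower K A A p) (_ ⊗ₜ z))
          (LinearMap.lTensor_id_apply H (Tower K A A p) (coactPow ρ p x)).symm).trans ?_
        rw [mulFst_map, ← LinearMap.comp_apply (LinearMap.lTensor H _) (LinearMap.lTensor H _),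
          ← LinearMap.lTensor_comp, LinearMap.comp_assoc, ← LinearEquiv.coe_trans,
          LinearEquiv.self_trans_symm]
        rfl
    | succ i =>
      refine TensorProduct.ext' fun a x => ?_
      change mulFst K H A (Tower K A A p) (ρ a ⊗ₜ (coactPow ρ p ∘ₗ mulAt K A p i) x) =
        (TensorProduct.map LinearMap.id (mulAt K A p i)).lTensor H
          (mulFst K H A (Tower K A A (p + 1)) (ρ a ⊗ₜ coactPow ρ (p + 1) x))
      rw [← mulFst_map, ih i, LinearMap.lTensor_id_apply]
      rfl

/-- The diagonal coaction is defined by peeling off the first factor; associativity of `H` permits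
peeling off the last one, as the right action in the Hochschild coboundary requires. -/
theorem coactPow_comp_splitLast (p : ℕ) :
    (splitLast K A p).lTensor H ∘ₗ coactPow ρ (p + 1) =
      mulFst K H (Tower K A A p) A ∘ₗ TensorProduct.map (coactPow ρ p) ρ ∘ₗ splitLast K A p := by
  induction p with
  | zero =>
    refine TensorProduct.ext' fun a x => ?_
    exact LinearMap.lTensor_id_apply H _ _
  | succ p ih =>
    refine TensorProduct.ext' fun a x => ?_
    have key : ((TensorProduct.assoc K A (Tower K A A p) A).symm.toLinearMap.lTensor H) ∘ₗ
        mulFst K H A (Tower K A A p ⊗[K] A) ∘ₗ TensorProduct.mk K _ _ (ρ a) ∘ₗ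
          mulFst K H (Tower K A A p) A ∘ₗ TensorProduct.map (coactPow ρ p) ρ =
        mulFst K H (Tower K A A (p + 1)) A ∘ₗ TensorProduct.map (coactPow ρ (p + 1)) ρ ∘ₗ
          (TensorProduct.assoc K A (Tower K A A p) A).symm.toLinearMap ∘ₗ
            TensorProduct.mk K A (Tower K A A p ⊗[K] A) a := by
      refine TensorProduct.ext' fun y b => ?_
      change (TensorProduct.assoc K A (Tower K A A p) A).symm.toLinearMap.lTensor H
        (mulFst K H A (Tower K A A p ⊗[K] A) (ρ a ⊗ₜ
          mulFst K H (Tower K A A p) A (coactPow ρ p y ⊗ₜ ρ b))) =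
        mulFst K H (A ⊗[K] Tower K A A p) A
          (mulFst K H A (Tower K A A p) (ρ a ⊗ₜ coactPow ρ p y) ⊗ₜ ρ b)
      rw [← mulFst_assoc, ← LinearMap.comp_apply, ← LinearMap.lTensor_comp, ← LinearEquiv.coe_trans,
          LinearEquiv.self_trans_symm]
      exact LinearMap.lTensor_id_apply H _ _
    refine Eq.trans ?_ (LinearMap.congr_fun key (splitLast K A (p) x))
    have h1 := mulFst_map (LinearMap.id (R := K) (M := A)) (splitLast K A p) (ρ a)
      (coactPow ρ (p + 1) x)
    change ((TensorProduct.assoc K A (Tower K A A p) A).symm.toLinearMap ∘ₗ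
      (splitLast K A p).lTensor A).lTensor H (mulFst K H A (Tower K A A (p + 1)) (ρ a ⊗ₜ
        coactPow ρ (p + 1) x)) = (TensorProduct.assoc K A (Tower K A A p) A).symm.toLinearMap.lTensor H
        (mulFst K H A (Tower K A A p ⊗[K] A) (ρ a ⊗ₜ _))
    rw [LinearMap.lTensor_comp]
    refine congrArg ((TensorProduct.assoc K A (Tower K A A p) A).symm.toLinearMap.lTensor H)
      (h1.symm.trans ?_)
    rw [LinearMap.lTensor_id_apply]
    exact congrArg (fun z => mulFst K H A (Tower K A A p ⊗[K] A) (ρ a ⊗ₜ z))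
      (LinearMap.congr_fun ih x)

/-- Multiplicativity of `Δ` distributes it over the product of the coefficients in `H`, which
reduces the claim to coassociativity of `ρ` on each factor. -/
theorem coactPow_coassoc (hΔ : IsBialgebra Δ) (hρ : IsComoduleAlgebra Δ ρ) (p : ℕ) :
    (coactPow ρ p).lTensor H ∘ₗ coactPow ρ p =
      (TensorProduct.assoc K H H (Tower K A A p)).toLinearMap ∘ₗ Δ.rTensor (Tower K A A p) ∘ₗ
        coactPow ρ p := by
  induction p with
  | zero => exact hρ.coassoc
  | succ p ih =>
    -- `m` multiplies both `H` factors at once; each side becomes `m` applied to the corresponding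
    -- side for the separate factors.
    let m : (H ⊗[K] (H ⊗[K] A)) ⊗[K] (H ⊗[K] (H ⊗[K] Tower K A A p)) →ₗ[K]
      H ⊗[K] (H ⊗[K] Tower K A A (p + 1)) :=
      (mulFst K H A (Tower K A A p)).lTensor H ∘ₗ mulFst K H (H ⊗[K] A) (H ⊗[K] Tower K A A p)
    have h1 : (coactPow ρ (p + 1)).lTensor H ∘ₗ mulFst K H A (Tower K A A p) =
        m ∘ₗ TensorProduct.map (ρ.lTensor H) ((coactPow ρ p).lTensor H) :=
      TensorProduct.ext_fourfold' fun h a k x => rfl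
    have h2 : (TensorProduct.assoc K H H (Tower K A A (p + 1))).toLinearMap ∘ₗ
        Δ.rTensor (Tower K A A (p + 1)) ∘ₗ mulFst K H A (Tower K A A p) =
        m ∘ₗ TensorProduct.map ((TensorProduct.assoc K H H A).toLinearMap ∘ₗ Δ.rTensor A)
          ((TensorProduct.assoc K H H (Tower K A A p)).toLinearMap ∘ₗ
            Δ.rTensor (Tower K A A p)) := by
      refine TensorProduct.ext_fourfold' fun h a k x => ?_
      have key : (TensorProduct.assoc K H H (Tower K A A (p + 1))).toLinearMap ∘ₗ
          (TensorProduct.mk K (H ⊗[K] H) (Tower K A A (p + 1))).flip (a ⊗ₜ x) ∘ₗ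
            TensorProduct.map (LinearMap.mul' K H) (LinearMap.mul' K H) ∘ₗ
              (TensorProduct.tensorTensorTensorComm K H H H H).toLinearMap =
          m ∘ₗ TensorProduct.map
            ((TensorProduct.assoc K H H A).toLinearMap ∘ₗ
              (TensorProduct.mk K (H ⊗[K] H) A).flip a)
            ((TensorProduct.assoc K H H (Tower K A A p)).toLinearMap ∘ₗ
              (TensorProduct.mk K (H ⊗[K] H) (Tower K A A p)).flip x) :=
        TensorProduct.ext_fourfold' fun a b c d => rfl
      exact (congrArg (fun z => TensorProduct.assoc K H H (Tower K A A (p + 1))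
        (z ⊗ₜ (a ⊗ₜ x))) (LinearMap.congr_fun hΔ.comul_mul (h ⊗ₜ k))).trans
          (LinearMap.congr_fun key (Δ h ⊗ₜ Δ k))
    refine TensorProduct.ext' fun a x => ?_
    refine (LinearMap.congr_fun h1 (ρ a ⊗ₜ coactPow ρ p x)).trans ?_
    refine Eq.trans ?_ (LinearMap.congr_fun h2 (ρ a ⊗ₜ coactPow ρ p x)).symm
    exact congrArg m (congrArg₂ (· ⊗ₜ[K] ·) (LinearMap.congr_fun hρ.coassoc a)
      (LinearMap.congr_fun ih x))

end

end Coaction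

/-! ### The vertical differential, the bicomplex and its total complex. -/

section Bicomplex

variable {K : Type w} [Field K] {H A : Type u}
  [NonUnitalRing H] [Module K H] [IsScalarTower K H H] [SMulCommClass K H H]
  [NonUnitalRing A] [Module K A] [IsScalarTower K A A] [SMulCommClass K A A]
  {Δ : H →ₗ[K] H ⊗[K] H} {ρ : A →ₗ[K] H ⊗[K] A}

/-- For `i = k` this is coassociativity of `Δ`; otherwise the two comultiplications act on different
factors. -/
theorem comulAt_comulAt (hΔ : IsBialgebra Δ) (q : ℕ) (i k : Fin q) (h : i ≤ k) :
    comulAt A Δ (q + 1) k.succ ∘ₗ comulAt A Δ q i =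
      comulAt A Δ (q + 1) i.castSucc ∘ₗ comulAt A Δ q k := by
  induction q with
  | zero => exact i.elim0
  | succ q ih =>
    cases i using Fin.cases with
    | zero =>
      refine TensorProduct.ext' fun x y => ?_
      cases k using Fin.cases with
      | zero =>
        have k1 : (comulAt A Δ (q + 1) 0).lTensor H ∘ₗ
            (TensorProduct.assoc K H H (Tower K H A q)).toLinearMap ∘ₗ
              (TensorProduct.mk K (H ⊗[K] H) (Tower K H A q)).flip y =
            (TensorProduct.assoc K H H (Tower K H A q)).toLinearMap.lTensor H ∘ₗ
              (TensorProduct.assoc K H (H ⊗[K] H) (Tower K H A q)).toLinearMap ∘ₗ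
                (TensorProduct.mk K (H ⊗[K] (H ⊗[K] H)) (Tower K H A q)).flip y ∘ₗ
                  Δ.lTensor H :=
          TensorProduct.ext' fun h k => rfl
        have k2 : comulAt A Δ (q + 2) 0 ∘ₗ
            (TensorProduct.assoc K H H (Tower K H A q)).toLinearMap ∘ₗ
              (TensorProduct.mk K (H ⊗[K] H) (Tower K H A q)).flip y =
            (TensorProduct.assoc K H H (Tower K H A q)).toLinearMap.lTensor H ∘ₗ
              (TensorProduct.assoc K H (H ⊗[K] H) (Tower K H A q)).toLinearMap ∘ₗ
                (TensorProduct.mk K (H ⊗[K] (H ⊗[K] H)) (Tower K H A q)).flip y ∘ₗ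
                  (TensorProduct.assoc K H H H).toLinearMap ∘ₗ Δ.rTensor H := by
          refine TensorProduct.ext' fun h k => ?_
          have k3 : (TensorProduct.assoc K H H (Tower K H A (q + 1))).toLinearMap ∘ₗ
              (TensorProduct.mk K (H ⊗[K] H) (Tower K H A (q + 1))).flip (k ⊗ₜ y) =
              (TensorProduct.assoc K H H (Tower K H A q)).toLinearMap.lTensor H ∘ₗ
              (TensorProduct.assoc K H (H ⊗[K] H) (Tower K H A q)).toLinearMap ∘ₗ
                (TensorProduct.mk K (H ⊗[K] (H ⊗[K] H)) (Tower K H A q)).flip y ∘ₗ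
                  (TensorProduct.assoc K H H H).toLinearMap ∘ₗ
                    (TensorProduct.mk K (H ⊗[K] H) H).flip k :=
            TensorProduct.ext' fun h k => rfl
          exact LinearMap.congr_fun k3 (Δ h)
        refine (LinearMap.congr_fun k1 (Δ x)).trans (Eq.trans ?_
          (LinearMap.congr_fun k2 (Δ x)).symm)
        exact congrArg (fun z => (TensorProduct.assoc K H H (Tower K H A q)).toLinearMap.lTensor H
          (TensorProduct.assoc K H (H ⊗[K] H) (Tower K H A q) (z ⊗ₜ y)))
            (LinearMap.congr_fun hΔ.coassoc x).symm
      | succ k =>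
        have key : ((comulAt A Δ q k).lTensor H).lTensor H ∘ₗ
            (TensorProduct.assoc K H H (Tower K H A q)).toLinearMap ∘ₗ
              (TensorProduct.mk K (H ⊗[K] H) (Tower K H A q)).flip y =
            (TensorProduct.assoc K H H (Tower K H A (q + 1))).toLinearMap ∘ₗ
              (TensorProduct.mk K (H ⊗[K] H) (Tower K H A (q + 1))).flip (comulAt A Δ q k y) :=
          TensorProduct.ext' fun h k => rfl
        exact LinearMap.congr_fun key (Δ x)
    | succ i =>
      cases k using Fin.cases with
      | zero => exact absurd h (by simp)
      | succ k =>
        change (comulAt A Δ (q + 1) k.succ).lTensor H ∘ₗ (comulAt A Δ q i).lTensor H =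
          (comulAt A Δ (q + 1) i.castSucc).lTensor H ∘ₗ (comulAt A Δ q k).lTensor H
        rw [← LinearMap.lTensor_comp, ← LinearMap.lTensor_comp,
          ih i k (Fin.succ_le_succ_iff.mp h)]

theorem coactLast_comp_comulAt (q : ℕ) (i : Fin q) :
    coactLast ρ (q + 1) ∘ₗ comulAt A Δ q i =
      comulAt A Δ (q + 1) i.castSucc ∘ₗ coactLast ρ q := by
  induction q with
  | zero => exact i.elim0
  | succ q ih =>
    cases i using Fin.cases with
    | zero =>
      refine TensorProduct.ext' fun x y => ?_
      have key : ((coactLast ρ q).lTensor H).lTensor H ∘ₗ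
          (TensorProduct.assoc K H H (Tower K H A q)).toLinearMap ∘ₗ
            (TensorProduct.mk K (H ⊗[K] H) (Tower K H A q)).flip y =
          (TensorProduct.assoc K H H (Tower K H A (q + 1))).toLinearMap ∘ₗ
            (TensorProduct.mk K (H ⊗[K] H) (Tower K H A (q + 1))).flip (coactLast ρ q y) :=
        TensorProduct.ext' fun h k => rfl
      exact LinearMap.congr_fun key (Δ x)
    | succ i =>
      change (coactLast ρ (q + 1)).lTensor H ∘ₗ (comulAt A Δ q i).lTensor H =
        (comulAt A Δ (q + 1) i.castSucc).lTensor H ∘ₗ (coactLast ρ q).lTensor H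
      rw [← LinearMap.lTensor_comp, ← LinearMap.lTensor_comp, ih]

theorem coactLast_comp_coactLast (hρ : IsComoduleAlgebra Δ ρ) (q : ℕ) :
    coactLast ρ (q + 1) ∘ₗ coactLast ρ q =
      comulAt A Δ (q + 1) (Fin.last q) ∘ₗ coactLast ρ q := by
  induction q with
  | zero => exact hρ.coassoc
  | succ q ih =>
    change (coactLast ρ (q + 1)).lTensor H ∘ₗ (coactLast ρ q).lTensor H =
        (comulAt A Δ (q + 1) (Fin.last q)).lTensor H ∘ₗ (coactLast ρ q).lTensor H
    rw [← LinearMap.lTensor_comp, ← LinearMap.lTensor_comp, ih]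

variable (ρ) in
/-- The map `φ ↦ (Id_H ⊗ φ) ∘ ρ^{p+1}`. -/
def coactFirst (p q : ℕ) :
    (Tower K A A p →ₗ[K] Tower K H A q) →ₗ[K] (Tower K A A p →ₗ[K] Tower K H A (q + 1)) :=
  LinearMap.lcomp K _ (coactPow ρ p) ∘ₗ LinearMap.lTensorHom H

/-- `b` numbers its cofaces from the right of the tower, while the cosimplicial order used here runs
from the left. Reversal costs only a global sign, harmless for `b ∘ b = 0`. -/
theorem verticalB_eq_altSum (p q : ℕ) :
    verticalB Δ ρ p q = (-1 : K) ^ (q + 1) • altSum (coactFirst ρ p q)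
      (fun i : Fin q => LinearMap.llcomp K _ _ _ (comulAt A Δ q i))
      (LinearMap.llcomp K _ _ _ (coactLast ρ q)) := by
  ext1 φ
  change coactLast ρ q ∘ₗ φ
      + ∑ i : Fin q, (-1 : K) ^ ((i : ℕ) + 1) • (comulAt A Δ q i.rev ∘ₗ φ)
      + (-1 : K) ^ (q + 1) • (φ.lTensor H ∘ₗ coactPow ρ p) = _
  have h2 : ∀ n : ℕ, (-1 : K) ^ n * (-1) ^ n = 1 := fun n => by
    rw [← mul_pow]; simp
  simp only [altSum, LinearMap.smul_apply, LinearMap.add_apply, LinearMap.sum_apply, smul_add,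
    smul_smul, Finset.smul_sum, h2, one_smul]
  rw [← Equiv.sum_comp Fin.revPerm (fun i : Fin q => ((-1 : K) ^ (q + 1) * (-1) ^ ((i : ℕ) + 1)) •
    LinearMap.llcomp K (Tower K A A p) (Tower K H A q) (Tower K H A (q + 1)) (comulAt A Δ q i) φ)]
  -- The exponents at a position and at its reverse add up to `q + 1`, so the global sign turns one
  -- into the other.
  have h3 : ∀ i : Fin q, (-1 : K) ^ (q + 1) * (-1) ^ (((Fin.revPerm i : Fin q) : ℕ) + 1) =
      (-1) ^ ((i : ℕ) + 1) := by
    intro i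
    have e : q + 1 = (((Fin.revPerm i : Fin q) : ℕ) + 1) + ((i : ℕ) + 1) := by
      simp only [Fin.revPerm_apply, Fin.val_rev]; omega
    rw [e, pow_add, mul_right_comm, h2, one_mul]
  simp only [h3]
  rw [add_comm, add_comm (coactLast ρ q ∘ₗ φ), add_assoc]
  rfl

theorem verticalB_comp_verticalB (hΔ : IsBialgebra Δ) (hρ : IsComoduleAlgebra Δ ρ) (p q : ℕ) :
    verticalB Δ ρ p (q + 1) ∘ₗ verticalB Δ ρ p q = 0 := by
  rw [verticalB_eq_altSum, verticalB_eq_altSum, LinearMap.smul_comp, LinearMap.comp_smul,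
    altSum_comp_altSum, smul_zero, smul_zero]
  · ext1 φ
    change comulAt A Δ (q + 1) 0 ∘ₗ (φ.lTensor H ∘ₗ coactPow ρ p) =
      (φ.lTensor H ∘ₗ coactPow ρ p).lTensor H ∘ₗ coactPow ρ p
    rw [LinearMap.lTensor_comp, LinearMap.comp_assoc, coactPow_coassoc hΔ hρ]
    simp only [← LinearMap.comp_assoc]
    congr 1
    refine TensorProduct.ext' fun h x => ?_
    have key : (TensorProduct.assoc K H H (Tower K H A q)).toLinearMap ∘ₗ
          (TensorProduct.mk K (H ⊗[K] H) (Tower K H A q)).flip (φ x) =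
        (φ.lTensor H).lTensor H ∘ₗ (TensorProduct.assoc K H H (Tower K A A p)).toLinearMap ∘ₗ
          (TensorProduct.mk K (H ⊗[K] H) (Tower K A A p)).flip x :=
      TensorProduct.ext' fun h k => rfl
    exact LinearMap.congr_fun key (Δ h)
  · intro k
    ext1 φ
    change (comulAt A Δ q k).lTensor H ∘ₗ (φ.lTensor H ∘ₗ coactPow ρ p) =
      (comulAt A Δ q k ∘ₗ φ).lTensor H ∘ₗ coactPow ρ p
    rw [LinearMap.lTensor_comp, LinearMap.comp_assoc]
  · ext1 φ
    change (coactLast ρ q).lTensor H ∘ₗ (φ.lTensor H ∘ₗ coactPow ρ p) =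
      (coactLast ρ q ∘ₗ φ).lTensor H ∘ₗ coactPow ρ p
    rw [LinearMap.lTensor_comp, LinearMap.comp_assoc]
  · intro i k h
    ext1 φ
    exact congrArg (· ∘ₗ φ) (comulAt_comulAt hΔ q i k h)
  · intro i
    ext1 φ
    exact congrArg (· ∘ₗ φ) (coactLast_comp_comulAt q i)
  · ext1 φ
    exact congrArg (· ∘ₗ φ) (coactLast_comp_coactLast hρ q)

/-- This vertical coface is not a postcomposition, so `hochschildD_comp` does not apply. It commutes
with each Hochschild coface separately, thanks to the description of the diagonal coaction at the
first factor, at adjacent factors and at the last factor. -/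
theorem hochschildD_coactFirst (hρ : IsComoduleAlgebra Δ ρ) (p q : ℕ)
    (φ : Tower K A A p →ₗ[K] Tower K H A q) :
    hochschildD (leftAct Δ ρ (q + 1)) (rightAct Δ ρ (q + 1)) p (coactFirst ρ p q φ) =
      coactFirst ρ (p + 1) q (hochschildD (leftAct Δ ρ q) (rightAct Δ ρ q) p φ) := by
  rw [hochschildD_eq_altSum, hochschildD_eq_altSum]
  simp only [altSum, LinearMap.add_apply, LinearMap.sum_apply, LinearMap.smul_apply, map_add,
    map_sum, map_smul]
  have hl : hochschildFirst (leftAct Δ ρ (q + 1)) p (coactFirst ρ p q φ) =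
      coactFirst ρ (p + 1) q (hochschildFirst (leftAct Δ ρ q) p φ) := by
    refine TensorProduct.ext' fun a x => ?_
    have key : towerMul K H A (q + 1) ∘ₗ TensorProduct.map ((coactIter Δ ρ q).lTensor H)
        (φ.lTensor H) = (leftAct Δ ρ q ∘ₗ φ.lTensor A).lTensor H ∘ₗ
          mulFst K H A (Tower K A A p) :=
      TensorProduct.ext_fourfold' fun h x k y => rfl
    refine Eq.trans ?_ (LinearMap.congr_fun key (ρ a ⊗ₜ coactPow ρ p x))
    change towerMul K H A (q + 1) (coactIter Δ ρ (q + 1) a ⊗ₜ _) = _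
    rw [coactIter_succ hρ]
    rfl
  have hr : hochschildLast (rightAct Δ ρ (q + 1)) p (coactFirst ρ p q φ) =
      coactFirst ρ (p + 1) q (hochschildLast (rightAct Δ ρ q) p φ) := by
    change rightAct Δ ρ (q + 1) ∘ₗ (φ.lTensor H ∘ₗ coactPow ρ p).rTensor A ∘ₗ splitLast K A p =
      ((rightAct Δ ρ q ∘ₗ φ.rTensor A) ∘ₗ splitLast K A p).lTensor H ∘ₗ coactPow ρ (p + 1)
    rw [LinearMap.lTensor_comp, LinearMap.comp_assoc, coactPow_comp_splitLast]
    simp only [← LinearMap.comp_assoc]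
    congr 1
    refine TensorProduct.ext' fun x a => ?_
    have key : towerMul K H A (q + 1) ∘ₗ TensorProduct.map (φ.lTensor H)
        ((coactIter Δ ρ q).lTensor H) = (rightAct Δ ρ q ∘ₗ φ.rTensor A).lTensor H ∘ₗ
          mulFst K H (Tower K A A p) A :=
      TensorProduct.ext_fourfold' fun h x k y => rfl
    refine Eq.trans ?_ (LinearMap.congr_fun key (coactPow ρ p x ⊗ₜ ρ a))
    change towerMul K H A (q + 1) (_ ⊗ₜ coactIter Δ ρ (q + 1) a) = _
    rw [coactIter_succ hρ]
    rfl
  have hm : ∀ i, hochschildMid (Tower K H A (q + 1)) p i (coactFirst ρ p q φ) =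
      coactFirst ρ (p + 1) q (hochschildMid (Tower K H A q) p i φ) := by
    intro i
    change (φ.lTensor H ∘ₗ coactPow ρ p) ∘ₗ mulAt K A p i =
      (φ ∘ₗ mulAt K A p i).lTensor H ∘ₗ coactPow ρ (p + 1)
    rw [LinearMap.lTensor_comp, LinearMap.comp_assoc, coactPow_comp_mulAt hρ, LinearMap.comp_assoc]
  simp only [hl, hr, hm]

theorem hochschildD_verticalB (hΔ : IsBialgebra Δ) (hρ : IsComoduleAlgebra Δ ρ) (p q : ℕ)
    (φ : Tower K A A p →ₗ[K] Tower K H A q) :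
    hochschildD (leftAct Δ ρ (q + 1)) (rightAct Δ ρ (q + 1)) p (verticalB Δ ρ p q φ) =
      verticalB Δ ρ (p + 1) q (hochschildD (leftAct Δ ρ q) (rightAct Δ ρ q) p φ) := by
  have h1 : ∀ i, hochschildD (leftAct Δ ρ (q + 1)) (rightAct Δ ρ (q + 1)) p
      (comulAt A Δ q i ∘ₗ φ) =
      comulAt A Δ q i ∘ₗ hochschildD (leftAct Δ ρ q) (rightAct Δ ρ q) p φ := fun i =>
    hochschildD_comp _ _ _ _ _
      (comp_leftAct _ (comulAt_comp_towerMul hΔ q i) (comulAt_comp_coactIter hρ q i))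
      (comp_rightAct _ (comulAt_comp_towerMul hΔ q i) (comulAt_comp_coactIter hρ q i)) p φ
  have h2 : hochschildD (leftAct Δ ρ (q + 1)) (rightAct Δ ρ (q + 1)) p
      (coactLast ρ q ∘ₗ φ) =
      coactLast ρ q ∘ₗ hochschildD (leftAct Δ ρ q) (rightAct Δ ρ q) p φ :=
    hochschildD_comp _ _ _ _ _
      (comp_leftAct _ (coactLast_comp_towerMul hρ q) (coactLast_comp_coactIter hρ q))
      (comp_rightAct _ (coactLast_comp_towerMul hρ q) (coactLast_comp_coactIter hρ q)) p φ
  rw [verticalB_eq_altSum, verticalB_eq_altSum]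
  simp only [altSum, LinearMap.add_apply, LinearMap.sum_apply, LinearMap.smul_apply, map_add,
    map_sum, map_smul, hochschildD_coactFirst hρ, LinearMap.llcomp_apply', h1, h2]

theorem d_comp_d (hρ : IsComoduleAlgebra Δ ρ) (p q : ℕ) :
    d Δ ρ (p + 1) q ∘ₗ d Δ ρ p q = 0 := by
  ext1 φ
  exact Subtype.ext (LinearMap.congr_fun (hochschildD_comp_hochschildD_act hρ p q) φ.1)

theorem v_comp_v (hΔ : IsBialgebra Δ) (hρ : IsComoduleAlgebra Δ ρ) (p q : ℕ) :
    v Δ ρ p (q + 1) ∘ₗ v Δ ρ p q = 0 := by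
  have h : b Δ ρ p (q + 1) ∘ₗ b Δ ρ p q = 0 := by
    ext1 φ
    exact Subtype.ext (LinearMap.congr_fun (verticalB_comp_verticalB hΔ hρ p q) φ.1)
  rw [v, v, LinearMap.smul_comp, LinearMap.comp_smul, h, smul_zero, smul_zero]

/-- `d` and `b` commute, and the sign in `v` alternates from column to column. -/
theorem d_comp_v_add_v_comp_d (hΔ : IsBialgebra Δ) (hρ : IsComoduleAlgebra Δ ρ) (p q : ℕ) :
    d Δ ρ p (q + 1) ∘ₗ v Δ ρ p q + v Δ ρ (p + 1) q ∘ₗ d Δ ρ p q = 0 := by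
  have h : d Δ ρ p (q + 1) ∘ₗ b Δ ρ p q = b Δ ρ (p + 1) q ∘ₗ d Δ ρ p q := by
    ext1 φ
    exact Subtype.ext (hochschildD_verticalB hΔ hρ p q φ.1)
  rw [v, v, LinearMap.smul_comp, LinearMap.comp_smul, h, ← add_smul, pow_succ _ (p + 1 + 1),
    mul_neg, mul_one, add_neg_cancel, zero_smul]

theorem totD_comp_totD (hΔ : IsBialgebra Δ) (hρ : IsComoduleAlgebra Δ ρ) (n : ℕ) :
    totD Δ ρ (n + 1) ∘ₗ totD Δ ρ n = 0 := by
  refine LinearMap.ext fun x => funext fun s => ?_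
  obtain ⟨⟨p, q⟩, h⟩ := s
  change totH Δ ρ (n + 1) p q h (totD Δ ρ n x) + totV Δ ρ (n + 1) p q h (totD Δ ρ n x) = 0
  have dd : ∀ p q y, d Δ ρ (p + 1) q (d Δ ρ p q y) = 0 := fun p q y =>
    LinearMap.congr_fun (d_comp_d hρ p q) y
  have vv : ∀ p q y, v Δ ρ p (q + 1) (v Δ ρ p q y) = 0 := fun p q y =>
    LinearMap.congr_fun (v_comp_v hΔ hρ p q) y
  have dv : ∀ p q y, d Δ ρ p (q + 1) (v Δ ρ p q y) + v Δ ρ (p + 1) q (d Δ ρ p q y) = 0 :=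
    fun p q y => LinearMap.congr_fun (d_comp_v_add_v_comp_d hΔ hρ p q) y
  have hd : ∀ p q (h : (p + 1) + 1 + q = n + 1 + 1), totH Δ ρ (n + 1) (p + 1) q h (totD Δ ρ n x) =
      d Δ ρ p q (totH Δ ρ n p q (by omega) x) + d Δ ρ p q (totV Δ ρ n p q (by omega) x) :=
    fun p q h => map_add _ _ _
  have hv : ∀ p q (h : (p + 1) + (q + 1) = n + 1 + 1),
      totV Δ ρ (n + 1) p (q + 1) h (totD Δ ρ n x) =
      v Δ ρ p q (totH Δ ρ n p q (by omega) x) + v Δ ρ p q (totV Δ ρ n p q (by omega) x) :=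
    fun p q h => map_add _ _ _
  have hd0 : ∀ q (h : (0 + 1) + q = n + 1 + 1), totH Δ ρ (n + 1) 0 q h (totD Δ ρ n x) = 0 :=
    fun q h => rfl
  have hv0 : ∀ p (h : (p + 1) + 0 = n + 1 + 1), totV Δ ρ (n + 1) p 0 h (totD Δ ρ n x) = 0 :=
    fun q h => by cases q <;> rfl
  have tH0 : ∀ q (h : (0 + 1) + q = n + 1), totH Δ ρ n 0 q h x = 0 := fun q h => rfl
  have tV0 : ∀ p (h : (p + 1) + 0 = n + 1), totV Δ ρ n p 0 h x = 0 :=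
    fun p h => by cases p <;> rfl
  have tH : ∀ p q (h : (p + 1) + 1 + q = n + 1), totH Δ ρ n (p + 1) q h x =
    d Δ ρ p q (Tot.proj K H A n p q (by omega) x) := fun p q h => rfl
  have tV : ∀ p q (h : (p + 1) + (q + 1) = n + 1), totV Δ ρ n p (q + 1) h x =
    v Δ ρ p q (Tot.proj K H A n p q (by omega) x) := fun p q h => by cases p <;> rfl
  -- Each component of the square is `dd + (dv + vd) + vv`. Two steps back may leave the quadrant,
  -- hence the separate indices `0` and `1`.
  rcases p with _ | _ | p <;> rcases q with _ | _ | q <;>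
    simp only [hd, hv, hd0, hv0, tH0, tV0, tH, tV, map_zero, add_zero, zero_add, dd, vv, dv]

end Bicomplex

/-! ### Composition and tensor product of formal power series of maps. -/

section SeriesAlgebra

/-- Both sides run over the triples with sum `n`; this underlies associativity of composition and of
the tensor product of series. -/
theorem sum_antidiagonal_assoc {M : Type*} [AddCommMonoid M] (F : ℕ → ℕ → ℕ → M) (n : ℕ) :
    ∑ s ∈ Finset.HasAntidiagonal.antidiagonal n, ∑ t ∈ Finset.HasAntidiagonal.antidiagonal s.1, F t.1 t.2 s.2 =
      ∑ s ∈ Finset.HasAntidiagonal.antidiagonal n, ∑ t ∈ Finset.HasAntidiagonal.antidiagonal s.2, F s.1 t.1 t.2 := by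
  rw [Finset.sum_sigma', Finset.sum_sigma']
  refine Finset.sum_nbij' (fun x => ⟨(x.2.1, x.2.2 + x.1.2), (x.2.2, x.1.2)⟩)
    (fun x => ⟨(x.1.1 + x.2.1, x.2.2), (x.1.1, x.2.1)⟩) ?_ ?_ ?_ ?_ ?_
  · rintro ⟨⟨i, j⟩, ⟨k, l⟩⟩ h
    simp only [Finset.mem_sigma, Finset.HasAntidiagonal.mem_antidiagonal, and_true] at h ⊢
    omega
  · rintro ⟨⟨i, j⟩, ⟨k, l⟩⟩ h
    simp only [Finset.mem_sigma, Finset.HasAntidiagonal.mem_antidiagonal, and_true] at h ⊢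
    omega
  · rintro ⟨⟨i, j⟩, ⟨k, l⟩⟩ h
    simp only [Finset.mem_sigma, Finset.HasAntidiagonal.mem_antidiagonal] at h
    obtain ⟨h1, rfl⟩ := h
    rfl
  · rintro ⟨⟨i, j⟩, ⟨k, l⟩⟩ h
    simp only [Finset.mem_sigma, Finset.HasAntidiagonal.mem_antidiagonal] at h
    obtain ⟨h1, rfl⟩ := h
    rfl
  · intro _ _
    rfl

theorem sum_antidiagonal_eq_ends {M : Type*} [AddCommMonoid M] (F : ℕ → ℕ → M) {n : ℕ}
    (hn : n ≠ 0) (h : ∀ i j, i ≠ 0 → j ≠ 0 → i + j = n → F i j = 0) :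
    ∑ s ∈ Finset.HasAntidiagonal.antidiagonal n, F s.1 s.2 = F 0 n + F n 0 := by
  rw [Finset.sum_eq_add (0, n) (n, 0)]
  · intro e; exact hn (congrArg Prod.snd e)
  · rintro ⟨i, j⟩ hs ⟨h1, h2⟩
    rw [Finset.HasAntidiagonal.mem_antidiagonal] at hs
    dsimp only at hs ⊢
    refine h i j ?_ ?_ hs
    · rintro rfl; exact h1 (by rw [← hs, zero_add])
    · rintro rfl; exact h2 (by rw [← hs, add_zero])
  · intro e; exact absurd (by simp) e
  · intro e; exact absurd (by simp) e

namespace Series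

variable {K : Type w} [Field K] {X Y Z W X' Y' Z' : Type u}
  [AddCommGroup X] [Module K X] [AddCommGroup Y] [Module K Y] [AddCommGroup Z] [Module K Z]
  [AddCommGroup W] [Module K W]
  [AddCommGroup X'] [Module K X'] [AddCommGroup Y'] [Module K Y'] [AddCommGroup Z'] [Module K Z']

theorem const_zero (f : X →ₗ[K] Y) : const f 0 = f := rfl

theorem const_of_ne_zero (f : X →ₗ[K] Y) {n : ℕ} (hn : n ≠ 0) : const f n = 0 := if_neg hn

theorem id_zero : Series.id K X 0 = LinearMap.id := rfl

theorem comp_zero (g : Series K Y Z) (f : Series K X Y) : g.comp f 0 = g 0 ∘ₗ f 0 := by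
  simp [comp]

theorem tensor_zero (f : Series K X Y) (g : Series K X' Y') :
    f.tensor g 0 = TensorProduct.map (f 0) (g 0) := by
  simp [tensor]

theorem comp_assoc (h : Series K Z W) (g : Series K Y Z) (f : Series K X Y) :
    (h.comp g).comp f = h.comp (g.comp f) := by
  funext n
  simp only [comp, sum_comp, comp_sum]
  exact sum_antidiagonal_assoc (fun i j k => (h i ∘ₗ g j) ∘ₗ f k) n

theorem const_comp_apply (g : Y →ₗ[K] Z) (f : Series K X Y) (n : ℕ) :
    (const g).comp f n = g ∘ₗ f n := by
  rw [comp, Finset.sum_eq_single (0, n)]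
  · rfl
  · rintro ⟨i, j⟩ hs hne
    rw [Finset.HasAntidiagonal.mem_antidiagonal] at hs
    dsimp only at hs ⊢
    rw [const_of_ne_zero, LinearMap.zero_comp]
    rintro rfl
    exact hne (by rw [← hs, zero_add])
  · intro e; exact absurd (by simp) e

theorem comp_const_apply (g : Series K Y Z) (f : X →ₗ[K] Y) (n : ℕ) :
    g.comp (const f) n = g n ∘ₗ f := by
  rw [comp, Finset.sum_eq_single (n, 0)]
  · rfl
  · rintro ⟨i, j⟩ hs hne
    rw [Finset.HasAntidiagonal.mem_antidiagonal] at hs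
    dsimp only at hs ⊢
    rw [const_of_ne_zero, LinearMap.comp_zero]
    rintro rfl
    exact hne (by rw [← hs, add_zero])
  · intro e; exact absurd (by simp) e

theorem const_tensor_apply (g : Y →ₗ[K] Z) (f : Series K X' Y') (n : ℕ) :
    (const g).tensor f n = TensorProduct.map g (f n) := by
  rw [tensor, Finset.sum_eq_single (0, n)]
  · rfl
  · rintro ⟨i, j⟩ hs hne
    rw [Finset.HasAntidiagonal.mem_antidiagonal] at hs
    dsimp only at hs ⊢
    rw [const_of_ne_zero, TensorProduct.map_zero_left]
    rintro rfl
    exact hne (by rw [← hs, zero_add])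
  · intro e; exact absurd (by simp) e

theorem tensor_const_apply (g : Series K Y Z) (f : X' →ₗ[K] Y') (n : ℕ) :
    g.tensor (const f) n = TensorProduct.map (g n) f := by
  rw [tensor, Finset.sum_eq_single (n, 0)]
  · rfl
  · rintro ⟨i, j⟩ hs hne
    rw [Finset.HasAntidiagonal.mem_antidiagonal] at hs
    dsimp only at hs ⊢
    rw [const_of_ne_zero, TensorProduct.map_zero_right]
    rintro rfl
    exact hne (by rw [← hs, add_zero])
  · intro e; exact absurd (by simp) e

theorem id_comp (f : Series K X Y) : (Series.id K Y).comp f = f :=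
  funext fun n => (const_comp_apply _ f n).trans (LinearMap.id_comp _)

theorem comp_id (f : Series K X Y) : f.comp (Series.id K X) = f :=
  funext fun n => (comp_const_apply f _ n).trans (LinearMap.comp_id _)

theorem id_tensor_id : (Series.id K X).tensor (Series.id K Y) = Series.id K (X ⊗[K] Y) := by
  funext n
  rw [Series.id, const_tensor_apply, Series.id, Series.id]
  by_cases h : n = 0
  · subst h; exact TensorProduct.map_id
  · rw [const_of_ne_zero _ h, const_of_ne_zero _ h, TensorProduct.map_zero_right]

theorem tensor_eq_comp (f : Series K X Y) (g : Series K X' Y') :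
    f.tensor g = (f.tensor (Series.id K Y')).comp ((Series.id K X).tensor g) := by
  funext n
  rw [comp, tensor]
  refine Finset.sum_congr rfl fun s _ => ?_
  rw [Series.id, Series.id, tensor_const_apply, const_tensor_apply, ← TensorProduct.map_comp,
    LinearMap.comp_id, LinearMap.id_comp]

theorem tensor_eq_comp' (f : Series K X Y) (g : Series K X' Y') :
    f.tensor g = ((Series.id K Y).tensor g).comp (f.tensor (Series.id K X')) := by
  funext n
  rw [comp, tensor, ← Finset.Nat.sum_antidiagonal_swap]
  refine Finset.sum_congr rfl fun s _ => ?_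
  rw [Series.id, Series.id, tensor_const_apply, const_tensor_apply, ← TensorProduct.map_comp,
    LinearMap.comp_id, LinearMap.id_comp]
  rfl

theorem id_tensor_comp (g : Series K Y' Z') (f : Series K X' Y') :
    ((Series.id K X).tensor g).comp ((Series.id K X).tensor f) =
      (Series.id K X).tensor (g.comp f) := by
  funext n
  rw [Series.id, const_tensor_apply, comp, comp, map_sum_right]
  refine Finset.sum_congr rfl fun s _ => ?_
  rw [const_tensor_apply, const_tensor_apply, ← TensorProduct.map_comp, LinearMap.id_comp]

theorem comp_tensor_id (g : Series K Y Z) (f : Series K X Y) :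
    (g.tensor (Series.id K X')).comp (f.tensor (Series.id K X')) =
      (g.comp f).tensor (Series.id K X') := by
  funext n
  rw [Series.id, tensor_const_apply, comp, comp, map_sum_left]
  refine Finset.sum_congr rfl fun s _ => ?_
  rw [tensor_const_apply, tensor_const_apply, ← TensorProduct.map_comp, LinearMap.id_comp]

/-- The interchange law follows from the two factorizations of a tensor product into one-sided ones,
which avoids reindexing a fourfold sum. -/
theorem tensor_comp_tensor (g : Series K Y Z) (f : Series K X Y) (g' : Series K Y' Z')
    (f' : Series K X' Y') :
    (g.tensor g').comp (f.tensor f') = (g.comp f).tensor (g'.comp f') := by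
  rw [tensor_eq_comp g g', tensor_eq_comp f f', comp_assoc, ← comp_assoc _ _ (tensor _ _),
    ← tensor_eq_comp', tensor_eq_comp f g', tensor_eq_comp (g.comp f), ← comp_tensor_id,
    ← id_tensor_comp]
  simp only [comp_assoc]

theorem const_tensorTensorTensorComm_comp (X : Type u) [AddCommGroup X] [Module K X]
    (f : Series K Y Z) (g : Series K Y' Z') :
    (const (TensorProduct.tensorTensorTensorComm K X Z X Z').toLinearMap).comp
        (((Series.id K X).tensor f).tensor ((Series.id K X).tensor g)) =
      ((Series.id K (X ⊗[K] X)).tensor (f.tensor g)).comp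
        (const (TensorProduct.tensorTensorTensorComm K X Y X Y').toLinearMap) := by
  funext n
  rw [const_comp_apply, comp_const_apply, Series.id, Series.id, const_tensor_apply, tensor, tensor,
    map_sum_right, sum_comp, comp_sum]
  refine Finset.sum_congr rfl fun s _ => ?_
  rw [const_tensor_apply, const_tensor_apply]
  exact TensorProduct.ext_fourfold' fun a b c d => rfl

theorem const_assoc_comp (f : Series K X Y) (g : Series K X' Y') (h : Series K Z Z') :
    (const (TensorProduct.assoc K Y Y' Z').toLinearMap).comp ((f.tensor g).tensor h) =
      (f.tensor (g.tensor h)).comp (const (TensorProduct.assoc K X X' Z).toLinearMap) := by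
  funext n
  rw [const_comp_apply, comp_const_apply]
  simp only [tensor, map_sum_left, map_sum_right, sum_comp, comp_sum]
  rw [← sum_antidiagonal_assoc fun i j k =>
    TensorProduct.map (f i) (TensorProduct.map (g j) (h k)) ∘ₗ
      (TensorProduct.assoc K X X' Z).toLinearMap]
  refine Finset.sum_congr rfl fun s _ => Finset.sum_congr rfl fun t _ => ?_
  exact TensorProduct.ext_threefold fun a b c => rfl

/-- Such a series is a power series over the ring `Module.End K X` with constant term `1`, hence a
two-sided unit. -/
theorem exists_inverse (f : Series K X X) (hf : f 0 = LinearMap.id) :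
    ∃ g : Series K X X, g 0 = LinearMap.id ∧ f.comp g = Series.id K X ∧
      g.comp f = Series.id K X := by
  let F : PowerSeries (Module.End K X) := PowerSeries.mk f
  have hF : PowerSeries.constantCoeff F = ((1 : (Module.End K X)ˣ) : Module.End K X) := hf
  have e : ∀ n, PowerSeries.coeff n (1 : PowerSeries (Module.End K X)) = Series.id K X n := by
    intro n
    rw [PowerSeries.coeff_one]
    rfl
  have h1 : f.comp (fun n => PowerSeries.coeff n (PowerSeries.invOfUnit F 1)) =
      Series.id K X := by
    funext n
    rw [← e, ← PowerSeries.mul_invOfUnit F 1 hF, PowerSeries.coeff_mul]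
    simp only [F, PowerSeries.coeff_mk]
    rfl
  have h2 : comp (fun n => PowerSeries.coeff n (PowerSeries.invOfUnit F 1)) f =
      Series.id K X := by
    funext n
    rw [← e, ← PowerSeries.invOfUnit_mul F 1 hF, PowerSeries.coeff_mul]
    simp only [F, PowerSeries.coeff_mk]
    rfl
  refine ⟨_, ?_, h1, h2⟩
  have := congrFun h1 0
  rwa [comp_zero, hf, LinearMap.id_comp] at this

/-- The coefficients of `f` in degrees strictly between `0` and `n` vanish. -/
def Gap (n : ℕ) (f : Series K X Y) : Prop := ∀ i, i ≠ 0 → i < n → f i = 0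

/-- A gap in the outer series alone kills every mixed term. -/
theorem Gap.comp_apply {n : ℕ} (hn : n ≠ 0) {g : Series K Y Z} {f : Series K X Y} (hg : Gap n g) :
    g.comp f n = g 0 ∘ₗ f n + g n ∘ₗ f 0 := by
  refine sum_antidiagonal_eq_ends (fun i j => g i ∘ₗ f j) hn fun i j hi hj h => ?_
  rw [hg i hi (by omega), LinearMap.zero_comp]

theorem Gap.tensor_apply {n : ℕ} (hn : n ≠ 0) {f : Series K X Y} {g : Series K X' Y'}
    (hf : Gap n f) :
    f.tensor g n = TensorProduct.map (f 0) (g n) + TensorProduct.map (f n) (g 0) := by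
  refine sum_antidiagonal_eq_ends (fun i j => TensorProduct.map (f i) (g j)) hn
    fun i j hi hj h => ?_
  rw [hf i hi (by omega), TensorProduct.map_zero_left]

theorem comp_add (g : Series K Y Z) (f f' : Series K X Y) :
    g.comp (f + f') = g.comp f + g.comp f' := by
  funext n
  simp only [comp, Pi.add_apply, LinearMap.comp_add, Finset.sum_add_distrib]

theorem comp_sub (g : Series K Y Z) (f f' : Series K X Y) :
    g.comp (f - f') = g.comp f - g.comp f' := by
  funext n
  simp only [comp, Pi.sub_apply, LinearMap.comp_sub, Finset.sum_sub_distrib]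

theorem add_comp (g g' : Series K Y Z) (f : Series K X Y) :
    comp (g + g') f = g.comp f + g'.comp f := by
  funext n
  simp only [comp, Pi.add_apply, LinearMap.add_comp, Finset.sum_add_distrib]

theorem tensor_add (g : Series K X' Y') (f f' : Series K X Y) :
    g.tensor (f + f') = g.tensor f + g.tensor f' := by
  funext n
  simp only [tensor, Pi.add_apply, TensorProduct.map_add_right, Finset.sum_add_distrib]

theorem add_tensor (g : Series K X' Y') (f f' : Series K X Y) :
    tensor (f + f') g = f.tensor g + f'.tensor g := by
  funext n
  simp only [tensor, Pi.add_apply, TensorProduct.map_add_left, Finset.sum_add_distrib]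

/-- The coefficients of `f` in degrees less than `n` vanish. -/
def VanishBelow (n : ℕ) (f : Series K X Y) : Prop := ∀ i, i < n → f i = 0

theorem VanishBelow.comp_right {n : ℕ} {f : Series K X Y} (hf : VanishBelow n f)
    (g : Series K Y Z) : VanishBelow n (g.comp f) := fun k hk =>
  Finset.sum_eq_zero fun s hs => by
    rw [Finset.HasAntidiagonal.mem_antidiagonal] at hs
    rw [hf s.2 (by omega), LinearMap.comp_zero]

theorem VanishBelow.comp_right_apply {n : ℕ} {f : Series K X Y} (hf : VanishBelow n f)
    (g : Series K Y Z) : g.comp f n = g 0 ∘ₗ f n := by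
  refine Finset.sum_eq_single (0, n) ?_ (fun e => absurd (by simp) e)
  rintro ⟨i, j⟩ hs hne
  rw [Finset.HasAntidiagonal.mem_antidiagonal] at hs
  have : j ≠ n := by rintro rfl; exact hne (by simpa using hs)
  dsimp only at hs ⊢
  rw [hf j (by omega), LinearMap.comp_zero]

theorem VanishBelow.tensor_left {n : ℕ} {f : Series K X Y} (hf : VanishBelow n f)
    (g : Series K X' Y') : VanishBelow n (f.tensor g) := fun k hk =>
  Finset.sum_eq_zero fun s hs => by
    rw [Finset.HasAntidiagonal.mem_antidiagonal] at hs
    rw [hf s.1 (by omega), TensorProduct.map_zero_left]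

theorem VanishBelow.tensor_left_apply {n : ℕ} {f : Series K X Y} (hf : VanishBelow n f)
    (g : Series K X' Y') : f.tensor g n = TensorProduct.map (f n) (g 0) := by
  refine Finset.sum_eq_single (n, 0) ?_ (fun e => absurd (by simp) e)
  rintro ⟨i, j⟩ hs hne
  rw [Finset.HasAntidiagonal.mem_antidiagonal] at hs
  have : i ≠ n := by rintro rfl; exact hne (by simpa using hs)
  dsimp only at hs ⊢
  rw [hf i (by omega), TensorProduct.map_zero_left]

theorem VanishBelow.tensor_right {n : ℕ} {f : Series K X Y} (hf : VanishBelow n f)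
    (g : Series K X' Y') : VanishBelow n (g.tensor f) := fun k hk =>
  Finset.sum_eq_zero fun s hs => by
    rw [Finset.HasAntidiagonal.mem_antidiagonal] at hs
    rw [hf s.2 (by omega), TensorProduct.map_zero_right]

theorem VanishBelow.tensor_right_apply {n : ℕ} {f : Series K X Y} (hf : VanishBelow n f)
    (g : Series K X' Y') : g.tensor f n = TensorProduct.map (g 0) (f n) := by
  refine Finset.sum_eq_single (0, n) ?_ (fun e => absurd (by simp) e)
  rintro ⟨i, j⟩ hs hne
  rw [Finset.HasAntidiagonal.mem_antidiagonal] at hs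
  have : j ≠ n := by rintro rfl; exact hne (by simpa using hs)
  dsimp only at hs ⊢
  rw [hf j (by omega), TensorProduct.map_zero_right]

theorem comp_congr_right {n : ℕ} (g : Series K Y Z) {f f' : Series K X Y}
    (h : ∀ i ≤ n, f i = f' i) : g.comp f n = g.comp f' n :=
  Finset.sum_congr rfl fun s hs => by
    rw [Finset.HasAntidiagonal.mem_antidiagonal] at hs
    rw [h s.2 (by omega)]

theorem tensor_congr {n : ℕ} {f f' : Series K X Y} {g g' : Series K X' Y'}
    (hf : ∀ i ≤ n, f i = f' i) (hg : ∀ i ≤ n, g i = g' i) : f.tensor g n = f'.tensor g' n :=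
  Finset.sum_congr rfl fun s hs => by
    rw [Finset.HasAntidiagonal.mem_antidiagonal] at hs
    rw [hf s.1 (by omega), hg s.2 (by omega)]

end Series

end SeriesAlgebra

/-! ### Conjugation of deformations. -/

section Conjugation

variable {K : Type w} [Field K] {H A : Type u}
  [NonUnitalRing H] [Module K H] [IsScalarTower K H H] [SMulCommClass K H H]
  [NonUnitalRing A] [Module K A] [IsScalarTower K A A] [SMulCommClass K A A]
  {Δ : H →ₗ[K] H ⊗[K] H} {ρ : A →ₗ[K] H ⊗[K] A}
  {R : Series K A (H ⊗[K] A)} {P : Series K (A ⊗[K] A) A}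

theorem const_comul_comp_id_tensor (Δ : H →ₗ[K] H ⊗[K] H) (f : Series K A A) :
    (Series.const ((TensorProduct.assoc K H H A).toLinearMap ∘ₗ Δ.rTensor A)).comp
        ((Series.id K H).tensor f) =
      ((Series.id K H).tensor ((Series.id K H).tensor f)).comp
        (Series.const ((TensorProduct.assoc K H H A).toLinearMap ∘ₗ Δ.rTensor A)) := by
  funext n
  rw [Series.const_comp_apply, Series.comp_const_apply, Series.id, Series.const_tensor_apply,
    Series.const_tensor_apply, Series.const_tensor_apply]
  refine TensorProduct.ext' fun h a => ?_
  have key : (TensorProduct.assoc K H H A).toLinearMap ∘ₗ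
      (TensorProduct.mk K (H ⊗[K] H) A).flip (f n a) =
      TensorProduct.map LinearMap.id (TensorProduct.map LinearMap.id (f n)) ∘ₗ
        (TensorProduct.assoc K H H A).toLinearMap ∘ₗ (TensorProduct.mk K (H ⊗[K] H) A).flip a :=
    TensorProduct.ext' fun h k => rfl
  exact LinearMap.congr_fun key (Δ h)

/-- Conjugating a deformation by an invertible series with constant term the identity yields a
deformation. -/
theorem IsDeformation.conj (h : IsDeformation Δ ρ R P) {Φ Ψ : Series K A A}
    (hΦ : Φ 0 = LinearMap.id) (hΨ : Ψ 0 = LinearMap.id) (hΦΨ : Φ.comp Ψ = Series.id K A) :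
    IsDeformation Δ ρ (((Series.id K H).tensor Ψ).comp (R.comp Φ))
      (Ψ.comp (P.comp (Φ.tensor Φ))) where
  coact_zero := by
    rw [Series.comp_zero, Series.comp_zero, Series.tensor_zero, hΦ, hΨ, Series.id_zero,
      TensorProduct.map_id, h.coact_zero, LinearMap.comp_id, LinearMap.id_comp]
  mul_zero := by
    rw [Series.comp_zero, Series.comp_zero, Series.tensor_zero, hΦ, hΨ,
      TensorProduct.map_id, h.mul_zero, LinearMap.comp_id, LinearMap.id_comp]
  coassoc := by
    rw [← Series.comp_assoc (Series.const _), const_comul_comp_id_tensor, Series.comp_assoc,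
      ← Series.comp_assoc (Series.const _) R, ← h.coassoc, ← Series.id_tensor_comp,
      ← Series.id_tensor_comp]
    simp only [Series.comp_assoc]
    -- Between the two conjugated copies of `R`, the factors `Id ⊗ Φ` and `Id ⊗ Ψ` meet and cancel.
    rw [← Series.comp_assoc (Series.tensor _ Φ) (Series.tensor _ Ψ), Series.id_tensor_comp, hΦΨ,
      Series.id_tensor_id, Series.id_comp]
  coact_mul := by
    have e1 : (Series.const (LinearMap.mul' K H)).tensor (Ψ.comp (P.comp (Φ.tensor Φ))) =
        ((Series.id K H).tensor Ψ).comp (((Series.const (LinearMap.mul' K H)).tensor P).comp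
          ((Series.id K (H ⊗[K] H)).tensor (Φ.tensor Φ))) := by
      rw [Series.tensor_comp_tensor, Series.tensor_comp_tensor, Series.comp_id, Series.id_comp]
    have e2 : (((Series.id K H).tensor Ψ).comp (R.comp Φ)).tensor
        (((Series.id K H).tensor Ψ).comp (R.comp Φ)) =
        (((Series.id K H).tensor Ψ).tensor ((Series.id K H).tensor Ψ)).comp
          ((R.tensor R).comp (Φ.tensor Φ)) := by
      rw [Series.tensor_comp_tensor, Series.tensor_comp_tensor]
    have e3 : ((Series.id K (H ⊗[K] H)).tensor (Φ.tensor Φ)).comp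
        ((Series.id K (H ⊗[K] H)).tensor (Ψ.tensor Ψ)) = Series.id K _ := by
      rw [Series.id_tensor_comp, Series.tensor_comp_tensor, hΦΨ, Series.id_tensor_id,
        Series.id_tensor_id]
    rw [e1, e2, ← Series.comp_assoc (Series.const _), Series.const_tensorTensorTensorComm_comp]
    simp only [Series.comp_assoc]
    rw [← Series.comp_assoc (Series.tensor _ (Φ.tensor Φ)), e3, Series.id_comp,
      ← Series.comp_assoc Φ Ψ, hΦΨ, Series.id_comp, ← Series.comp_assoc R P, h.coact_mul]
    simp only [Series.comp_assoc]
  assoc := by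
    have e1 : (Φ.tensor Φ).comp ((Ψ.comp (P.comp (Φ.tensor Φ))).tensor (Series.id K A)) =
        (P.tensor (Series.id K A)).comp ((Φ.tensor Φ).tensor Φ) := by
      rw [Series.tensor_comp_tensor, Series.tensor_comp_tensor, ← Series.comp_assoc, hΦΨ,
        Series.id_comp, Series.id_comp, Series.comp_id]
    have e2 : (Φ.tensor Φ).comp ((Series.id K A).tensor (Ψ.comp (P.comp (Φ.tensor Φ)))) =
        ((Series.id K A).tensor P).comp (Φ.tensor (Φ.tensor Φ)) := by
      rw [Series.tensor_comp_tensor, Series.tensor_comp_tensor, ← Series.comp_assoc, hΦΨ,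
        Series.id_comp, Series.id_comp, Series.comp_id]
    simp only [Series.comp_assoc]
    rw [e1, ← Series.comp_assoc (Φ.tensor Φ), e2, Series.comp_assoc, ← Series.const_assoc_comp,
      ← Series.comp_assoc P, h.assoc]
    simp only [Series.comp_assoc]

end Conjugation

/-! ### Low-degree cochains, infinitesimals and their classes. -/

section Deformation

variable {K : Type w} [Field K] {H A : Type u}
  [NonUnitalRing H] [Module K H] [IsScalarTower K H H] [SMulCommClass K H H]
  [NonUnitalRing A] [Module K A] [IsScalarTower K A A] [SMulCommClass K A A]
  {Δ : H →ₗ[K] H ⊗[K] H} {ρ : A →ₗ[K] H ⊗[K] A}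
  {R : Series K A (H ⊗[K] A)} {P : Series K (A ⊗[K] A) A}

theorem altSum_fin_zero {M : Type*} [AddCommGroup M] [Module K M] (x z : M) (f : Fin 0 → M) :
    x + ∑ i : Fin 0, (-1 : K) ^ ((i : ℕ) + 1) • f i + (-1 : K) ^ (0 + 1) • z = x - z := by
  simp [sub_eq_add_neg]

theorem altSum_fin_one {M : Type*} [AddCommGroup M] [Module K M] (x z : M) (f : Fin 1 → M) :
    x + ∑ i : Fin 1, (-1 : K) ^ ((i : ℕ) + 1) • f i + (-1 : K) ^ (1 + 1) • z = x - f 0 + z := by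
  simp [sub_eq_add_neg]

theorem altSum_fin_two {M : Type*} [AddCommGroup M] [Module K M] (x z : M) (f : Fin 2 → M) :
    x + ∑ i : Fin 2, (-1 : K) ^ ((i : ℕ) + 1) • f i + (-1 : K) ^ (2 + 1) • z =
      x - f 0 + f 1 - z := by
  have e : (-1 : K) ^ (2 + 1) = -1 := by norm_num
  simp [Fin.sum_univ_two, sub_eq_add_neg, e, add_assoc]

theorem add_neg_one_pow_three_smul {M : Type*} [AddCommGroup M] [Module K M] (x y : M) :
    x + (-1 : K) ^ (1 + 1 + 1) • y = x - y := by
  have e : (-1 : K) ^ (1 + 1 + 1) = -1 := by norm_num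
  rw [e, neg_smul, one_smul, sub_eq_add_neg]

theorem verticalB_zero_zero (φ : A →ₗ[K] A) :
    verticalB Δ ρ 0 0 φ = ρ ∘ₗ φ - φ.lTensor H ∘ₗ ρ :=
  altSum_fin_zero (K := K) (ρ ∘ₗ φ) (φ.lTensor H ∘ₗ ρ) (fun i => comulAt A Δ 0 i.rev ∘ₗ φ)

theorem verticalB_zero_one (φ : A →ₗ[K] H ⊗[K] A) :
    verticalB Δ ρ 0 1 φ = ρ.lTensor H ∘ₗ φ
      - ((TensorProduct.assoc K H H A).toLinearMap ∘ₗ Δ.rTensor A) ∘ₗ φ + φ.lTensor H ∘ₗ ρ :=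
  altSum_fin_one (K := K) (ρ.lTensor H ∘ₗ φ) (φ.lTensor H ∘ₗ ρ)
    (fun i => comulAt A Δ 1 i.rev ∘ₗ φ)

theorem verticalB_one_zero (φ : A ⊗[K] A →ₗ[K] A) :
    verticalB Δ ρ 1 0 φ = ρ ∘ₗ φ - φ.lTensor H ∘ₗ coactPow ρ 1 :=
  altSum_fin_zero (K := K) (ρ ∘ₗ φ) (φ.lTensor H ∘ₗ coactPow ρ 1)
    (fun i => comulAt A Δ 0 i.rev ∘ₗ φ)

theorem hochschildD_zero {M : Type u} [AddCommGroup M] [Module K M] (l : A ⊗[K] M →ₗ[K] M)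
    (r : M ⊗[K] A →ₗ[K] M) (φ : A →ₗ[K] M) :
    hochschildD l r 0 φ = l ∘ₗ φ.lTensor A - φ ∘ₗ LinearMap.mul' K A + r ∘ₗ φ.rTensor A :=
  altSum_fin_one (K := K) (l ∘ₗ φ.lTensor A) (r ∘ₗ φ.rTensor A) (fun i => φ ∘ₗ mulAt K A 0 i)

theorem hochschildD_one_tmul {M : Type u} [AddCommGroup M] [Module K M] (l : A ⊗[K] M →ₗ[K] M)
    (r : M ⊗[K] A →ₗ[K] M) (φ : A ⊗[K] A →ₗ[K] M) (a b c : A) :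
    hochschildD l r 1 φ (a ⊗ₜ[K] (b ⊗ₜ[K] c)) = l (a ⊗ₜ φ (b ⊗ₜ c)) - φ ((a * b) ⊗ₜ c)
      + φ (a ⊗ₜ (b * c)) - r (φ (a ⊗ₜ b) ⊗ₜ c) :=
  LinearMap.congr_fun (altSum_fin_two (K := K) (l ∘ₗ φ.lTensor A)
    (r ∘ₗ φ.rTensor A ∘ₗ splitLast K A 1) (fun i => φ ∘ₗ mulAt K A 1 i)) (a ⊗ₜ[K] (b ⊗ₜ[K] c))

theorem mul_comp_map_of_mem_Der {φ : A →ₗ[K] A} (hφ : φ ∈ Der K A) :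
    LinearMap.mul' K A ∘ₗ TensorProduct.map LinearMap.id φ
      + LinearMap.mul' K A ∘ₗ TensorProduct.map φ LinearMap.id = φ ∘ₗ LinearMap.mul' K A :=
  TensorProduct.ext' fun a b => (hφ a b).symm

theorem pairCochain_sub (r r' : A →ₗ[K] H ⊗[K] A) (m m' : A ⊗[K] A →ₗ[K] A) :
    pairCochain r m - pairCochain r' m' = pairCochain (r - r') (m - m') := by
  refine funext fun s => ?_
  obtain ⟨⟨p, q⟩, h⟩ := s
  dsimp only at h
  obtain ⟨rfl, rfl⟩ | ⟨rfl, rfl⟩ : (p = 0 ∧ q = 1) ∨ (p = 1 ∧ q = 0) := by omega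
  · rfl
  · rfl

/-- The only component in degree 1 is `Der(A)`, where `d` vanishes by the Leibniz rule and `v`
carries the sign `+1`. -/
theorem pairCochain_mem_coboundaries_iff (r : A →ₗ[K] H ⊗[K] A) (m : A ⊗[K] A →ₗ[K] A) :
    pairCochain r m ∈ coboundaries Δ ρ 2 ↔
      m = 0 ∧ ∃ φ ∈ Der K A, r = ρ ∘ₗ φ - φ.lTensor H ∘ₗ ρ := by
  have hd : ∀ φ : C K H A 0 0, d Δ ρ 0 0 φ = 0 := by
    intro φ
    refine Subtype.ext ?_
    change hochschildD (leftAct Δ ρ 0) (rightAct Δ ρ 0) 0 φ.1 = 0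
    rw [hochschildD_zero]
    refine TensorProduct.ext' fun a b => ?_
    change a * φ.1 b - φ.1 (a * b) + φ.1 a * b = 0
    rw [φ.2 a b]
    abel
  have hv : ∀ φ : C K H A 0 0, (v Δ ρ 0 0 φ).1 = ρ ∘ₗ φ.1 - φ.1.lTensor H ∘ₗ ρ := by
    intro φ
    have e : (-1 : K) ^ (0 + 1 + 1) = 1 := by norm_num
    rw [v, e, one_smul, ← verticalB_zero_zero (Δ := Δ)]
    rfl
  constructor
  · rintro ⟨y, hy⟩
    have h1 : d Δ ρ 0 0 (Tot.proj K H A 1 0 0 rfl y) + 0 = ⟨m, trivial⟩ :=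
      congrFun hy ⟨(1, 0), rfl⟩
    have h2 : v Δ ρ 0 0 (Tot.proj K H A 1 0 0 rfl y) = ⟨r, trivial⟩ :=
      (zero_add (v Δ ρ 0 0 (Tot.proj K H A 1 0 0 rfl y))).symm.trans (congrFun hy ⟨(0, 1), rfl⟩)
    rw [hd, add_zero] at h1
    refine ⟨(congrArg Subtype.val h1).symm, (Tot.proj K H A 1 0 0 rfl y).1,
      (Tot.proj K H A 1 0 0 rfl y).2, ?_⟩
    exact (congrArg Subtype.val h2).symm.trans (hv _)
  · rintro ⟨rfl, φ, hφ, rfl⟩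
    refine ⟨fun s => match s with
      | ⟨(0, 0), _⟩ => ⟨φ, hφ⟩
      | ⟨(0, q + 1), h⟩ => absurd h (by dsimp only; omega)
      | ⟨(p + 1, q), h⟩ => absurd h (by dsimp only; omega), ?_⟩
    refine funext fun s => ?_
    obtain ⟨⟨p, q⟩, h⟩ := s
    dsimp only at h
    obtain ⟨rfl, rfl⟩ | ⟨rfl, rfl⟩ : (p = 0 ∧ q = 1) ∨ (p = 1 ∧ q = 0) := by omega
    · refine (zero_add (v Δ ρ 0 0 ⟨φ, hφ⟩)).trans (Subtype.ext (hv ⟨φ, hφ⟩))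
    · refine (add_zero (d Δ ρ 0 0 ⟨φ, hφ⟩)).trans (hd ⟨φ, hφ⟩)

/-- The gap leaves only the terms linear in `(R n, P n)`. The case `n = 1`, where the gap condition
is empty, gives infinitesimals; larger `n` serves rigidity. -/
theorem IsDeformation.pairCochain_mem_cocycles (h : IsDeformation Δ ρ R P) {n : ℕ} (hn : n ≠ 0)
    (hR : Series.Gap n R) (hP : Series.Gap n P) :
    pairCochain (R n) (P n) ∈ cocycles Δ ρ 2 := by
  -- `h1`, `h2`, `h3` are the `t^n` coefficients of the three axioms; they give the components in
  -- `C^{1,2}`, `C^{2,1}` and `C^{3,0}` respectively.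
  have h1 : ρ.lTensor H ∘ₗ R n + (R n).lTensor H ∘ₗ ρ =
      ((TensorProduct.assoc K H H A).toLinearMap ∘ₗ Δ.rTensor A) ∘ₗ R n := by
    have e := congrFun h.coassoc n
    have hT : Series.Gap n ((Series.id K H).tensor R) := fun i hi hin => by
      rw [Series.id, Series.const_tensor_apply, hR i hi hin, TensorProduct.map_zero_right]
    rw [hT.comp_apply hn, Series.const_comp_apply, Series.id, Series.const_tensor_apply,
      Series.const_tensor_apply, h.coact_zero] at e
    exact e
  have h2 : ρ ∘ₗ P n + R n ∘ₗ LinearMap.mul' K A =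
      TensorProduct.map (LinearMap.mul' K H) (LinearMap.mul' K A) ∘ₗ
        (TensorProduct.tensorTensorTensorComm K H A H A).toLinearMap ∘ₗ
          (TensorProduct.map ρ (R n) + TensorProduct.map (R n) ρ) +
      TensorProduct.map (LinearMap.mul' K H) (P n) ∘ₗ
        (TensorProduct.tensorTensorTensorComm K H A H A).toLinearMap ∘ₗ
          TensorProduct.map ρ ρ := by
    have e := congrFun h.coact_mul n
    have hT : Series.Gap n ((Series.const (LinearMap.mul' K H)).tensor P) := fun i hi hin => by
      rw [Series.const_tensor_apply, hP i hi hin, TensorProduct.map_zero_right]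
    rw [hR.comp_apply hn, hT.comp_apply hn, Series.const_comp_apply, Series.const_comp_apply,
      Series.const_tensor_apply, Series.const_tensor_apply, hR.tensor_apply hn,
      Series.tensor_zero, h.coact_zero, h.mul_zero] at e
    exact e
  have h3 : LinearMap.mul' K A ∘ₗ TensorProduct.map (P n) LinearMap.id +
      P n ∘ₗ TensorProduct.map (LinearMap.mul' K A) LinearMap.id =
      (LinearMap.mul' K A ∘ₗ TensorProduct.map LinearMap.id (P n) +
        P n ∘ₗ TensorProduct.map LinearMap.id (LinearMap.mul' K A)) ∘ₗ
          (TensorProduct.assoc K A A A).toLinearMap := by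
    have e := congrFun h.assoc n
    rw [hP.comp_apply hn, Series.comp_const_apply, hP.comp_apply hn, Series.id,
      Series.const_tensor_apply, Series.const_tensor_apply, Series.tensor_const_apply,
      Series.tensor_const_apply, h.mul_zero] at e
    exact e
  refine LinearMap.mem_ker.mpr (funext fun s => ?_)
  obtain ⟨⟨p, q⟩, hpq⟩ := s
  dsimp only at hpq
  obtain ⟨rfl, rfl⟩ | ⟨rfl, rfl⟩ | ⟨rfl, rfl⟩ :
    (p = 0 ∧ q = 2) ∨ (p = 1 ∧ q = 1) ∨ (p = 2 ∧ q = 0) := by omega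
  · refine (zero_add (v Δ ρ 0 1 ⟨R n, trivial⟩)).trans (Subtype.ext ?_)
    change (-1 : K) ^ (0 + 1 + 1) • verticalB Δ ρ 0 1 (R n) = 0
    rw [verticalB_zero_one, ← h1]
    simp
  · refine Subtype.ext (?_ : hochschildD (leftAct Δ ρ 1) (rightAct Δ ρ 1) 0 (R n) +
      (-1 : K) ^ (1 + 1 + 1) • verticalB Δ ρ 1 0 (P n) = 0)
    have k1 : leftAct Δ ρ 1 ∘ₗ (R n).lTensor A =
        TensorProduct.map (LinearMap.mul' K H) (LinearMap.mul' K A) ∘ₗ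
        (TensorProduct.tensorTensorTensorComm K H A H A).toLinearMap ∘ₗ
          TensorProduct.map ρ (R n) := TensorProduct.ext' fun a b => rfl
    have k2 : rightAct Δ ρ 1 ∘ₗ (R n).rTensor A =
        TensorProduct.map (LinearMap.mul' K H) (LinearMap.mul' K A) ∘ₗ
        (TensorProduct.tensorTensorTensorComm K H A H A).toLinearMap ∘ₗ
          TensorProduct.map (R n) ρ := TensorProduct.ext' fun a b => rfl
    have k3 : (P n).lTensor H ∘ₗ coactPow ρ 1 = TensorProduct.map (LinearMap.mul' K H) (P n) ∘ₗ
        (TensorProduct.tensorTensorTensorComm K H A H A).toLinearMap ∘ₗ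
          TensorProduct.map ρ ρ := by
      change (P n).lTensor H ∘ₗ (LinearMap.mul' K H).rTensor (A ⊗[K] A) ∘ₗ _ = _
      rw [← LinearMap.comp_assoc, LinearMap.lTensor_comp_rTensor]
      rfl
    refine (add_neg_one_pow_three_smul (K := K) _ _).trans ?_
    rw [hochschildD_zero, verticalB_one_zero, k1, k2, k3]
    rw [LinearMap.comp_add, LinearMap.comp_add] at h2
    refine Eq.trans ?_ (sub_eq_zero.mpr h2.symm)
    abel
  · refine (add_zero (d Δ ρ 1 0 ⟨P n, trivial⟩)).trans (Subtype.ext ?_)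
    change hochschildD (leftAct Δ ρ 0) (rightAct Δ ρ 0) 1 (P n) = 0
    refine TensorProduct.ext' fun a x => ?_
    induction x using TensorProduct.induction_on with
    | zero => simp
    | add x y hx hy => rw [TensorProduct.tmul_add, map_add, map_add, hx, hy]
    | tmul b c =>
      rw [hochschildD_one_tmul]
      have e : P n (a ⊗ₜ b) * c + P n ((a * b) ⊗ₜ c) =
        a * P n (b ⊗ₜ c) + P n (a ⊗ₜ (b * c)) := LinearMap.congr_fun h3 ((a ⊗ₜ b) ⊗ₜ c)
      change a * P n (b ⊗ₜ c) - P n ((a * b) ⊗ₜ c) + P n (a ⊗ₜ (b * c)) - P n (a ⊗ₜ b) * c = 0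
      rw [sub_add_eq_add_sub, ← e]
      abel

theorem Equivalent.infinitesimal_sub_mem {R' : Series K A (H ⊗[K] A)}
    {P' : Series K (A ⊗[K] A) A} (h : IsDeformation Δ ρ R P) (e : Equivalent R P R' P') :
    infinitesimal R P - infinitesimal R' P' ∈ coboundaries Δ ρ 2 := by
  obtain ⟨Φ, Ψ, hΦ, h1, h2, rfl, rfl⟩ := e
  have g : ∀ {X Y : Type u} [AddCommGroup X] [Module K X] [AddCommGroup Y] [Module K Y]
    (f : Series K X Y), Series.Gap 1 f := fun f i hi hi' => absurd (Nat.lt_one_iff.mp hi') hi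
  have hΨ : Ψ 0 = LinearMap.id := by
    have := congrFun h1 0
    rwa [Series.comp_zero, hΦ.zero, LinearMap.id_comp] at this
  have hΨ1 : Ψ 1 = -Φ 1 := by
    have := congrFun h1 1
    rw [(g Φ).comp_apply one_ne_zero, hΦ.zero, hΨ, LinearMap.id_comp, LinearMap.comp_id, Series.id,
      Series.const_of_ne_zero _ one_ne_zero] at this
    exact eq_neg_of_add_eq_zero_left this
  have hd : Φ 1 ∈ Der K A := by
    by_cases h0 : Φ 1 = 0
    · rw [h0]; exact zero_mem _
    · exact hΦ.derivation 1 le_rfl h0 fun m hm hm' => by omega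
  rw [infinitesimal, infinitesimal, pairCochain_sub, pairCochain_mem_coboundaries_iff]
  -- To first order, conjugation adds `ρ ∘ Φ 1 - (Id ⊗ Φ 1) ∘ ρ` to the coaction, so the difference
  -- taken here is the coboundary of `-Φ 1`. The multiplication term does not change, since `Φ 1` is
  -- a derivation.
  refine ⟨?_, -Φ 1, neg_mem hd, ?_⟩
  · rw [(g _).comp_apply one_ne_zero, (g _).comp_apply one_ne_zero, (g _).tensor_apply one_ne_zero,
      Series.comp_zero, Series.tensor_zero, hΦ.zero, hΨ, hΨ1, h.mul_zero, TensorProduct.map_id,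
      LinearMap.id_comp, LinearMap.comp_id, LinearMap.comp_add, mul_comp_map_of_mem_Der hd,
      LinearMap.id_comp, LinearMap.neg_comp]
    abel
  · rw [(g _).comp_apply one_ne_zero, (g _).comp_apply one_ne_zero,
      Series.comp_zero, Series.id, Series.const_tensor_apply, Series.const_tensor_apply, hΦ.zero,
      hΨ, hΨ1, h.coact_zero, TensorProduct.map_id,
      LinearMap.id_comp, LinearMap.comp_id, LinearMap.id_comp]
    change R 1 - (ρ ∘ₗ Φ 1 + (R 1 + (-Φ 1).lTensor H ∘ₗ ρ)) = _
    rw [LinearMap.lTensor_neg, LinearMap.neg_comp, LinearMap.comp_neg]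
    abel

/-! ### Rigidity -/

/-- The failure of `Φ` to carry the coaction `R` to `ρ`. -/
def coactDefect (ρ : A →ₗ[K] H ⊗[K] A) (R : Series K A (H ⊗[K] A)) (Φ : Series K A A) :
    Series K A (H ⊗[K] A) :=
  R.comp Φ - ((Series.id K H).tensor Φ).comp (Series.const ρ)

/-- The failure of `Φ` to carry the multiplication `P` to that of `A`. -/
def mulDefect (P : Series K (A ⊗[K] A) A) (Φ : Series K A A) : Series K (A ⊗[K] A) A :=
  P.comp (Φ.tensor Φ) - Φ.comp (Series.const (LinearMap.mul' K A))

/-- Only coefficients up to `n` enter, so approximations may be exchanged for their limit. -/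
theorem coactDefect_congr {n : ℕ} {Φ Φ' : Series K A A} (h : ∀ i ≤ n, Φ i = Φ' i) :
    coactDefect ρ R Φ n = coactDefect ρ R Φ' n := by
  rw [coactDefect, coactDefect, Pi.sub_apply, Pi.sub_apply, Series.comp_congr_right R h,
    Series.comp_const_apply, Series.comp_const_apply,
    Series.tensor_congr (fun _ _ => rfl) h]

theorem mulDefect_congr {n : ℕ} {Φ Φ' : Series K A A} (h : ∀ i ≤ n, Φ i = Φ' i) :
    mulDefect P Φ n = mulDefect P Φ' n := by
  rw [mulDefect, mulDefect, Pi.sub_apply, Pi.sub_apply,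
    Series.comp_congr_right P (fun i hi => Series.tensor_congr (fun j hj => h j (hj.trans hi))
      (fun j hj => h j (hj.trans hi))),
    Series.comp_const_apply, Series.comp_const_apply, h n le_rfl]

theorem coactDefect_add_apply (h : IsDeformation Δ ρ R P) {n : ℕ}
    {Φ S : Series K A A} (hS : Series.VanishBelow n S) :
    coactDefect ρ R (Φ + S) n =
      coactDefect ρ R Φ n + (ρ ∘ₗ S n - (S n).lTensor H ∘ₗ ρ) := by
  rw [coactDefect, coactDefect, Series.comp_add, Series.tensor_add, Series.add_comp]
  simp only [Pi.sub_apply, Pi.add_apply]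
  rw [hS.comp_right_apply, h.coact_zero, Series.comp_const_apply (Series.tensor _ S), Series.id,
    Series.const_tensor_apply _ S]
  change _ + _ - (_ + (S n).lTensor H ∘ₗ ρ) = _
  abel

/-- The terms linear in `S n` cancel by the Leibniz rule, and the quadratic term vanishes in degree
`n` because `S 0 = 0`. -/
theorem mulDefect_add_apply (h : IsDeformation Δ ρ R P) {n : ℕ} (hn : n ≠ 0)
    {Φ S : Series K A A} (hΦ : Φ 0 = LinearMap.id) (hS : Series.VanishBelow n S)
    (hSD : S n ∈ Der K A) : mulDefect P (Φ + S) n = mulDefect P Φ n := by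
  rw [mulDefect, mulDefect, Series.tensor_add, Series.add_tensor, Series.add_tensor,
    Series.comp_add, Series.comp_add, Series.comp_add, Series.add_comp]
  simp only [Pi.sub_apply, Pi.add_apply]
  rw [(hS.tensor_left Φ).comp_right_apply, (hS.tensor_right Φ).comp_right_apply,
    (hS.tensor_left S).comp_right_apply, hS.tensor_left_apply, hS.tensor_right_apply,
    hS.tensor_left_apply, hS 0 (Nat.pos_of_ne_zero hn), hΦ, h.mul_zero,
    Series.comp_const_apply S, ← mul_comp_map_of_mem_Der hSD, TensorProduct.map_zero_right,
    LinearMap.comp_zero]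
  abel

/-- Conjugating by `Φ` gives a deformation equal to the trivial one plus `Φ⁻¹` applied to the
defects. As `Φ⁻¹` starts with the identity, its `t^n` coefficients are those of the defects, and the
gap lemma applies. -/
theorem pairCochain_defect_mem_cocycles (h : IsDeformation Δ ρ R P) {n : ℕ} (hn : n ≠ 0)
    {Φ : Series K A A} (hΦ : Φ 0 = LinearMap.id)
    (hR : Series.VanishBelow n (coactDefect ρ R Φ)) (hP : Series.VanishBelow n (mulDefect P Φ)) :
    pairCochain (coactDefect ρ R Φ n) (mulDefect P Φ n) ∈ cocycles Δ ρ 2 := by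
  obtain ⟨Ψ, hΨ, h1, h2⟩ := Series.exists_inverse Φ hΦ
  have hc := h.conj hΦ hΨ h1
  have eR : ((Series.id K H).tensor Ψ).comp (R.comp Φ) =
      ((Series.id K H).tensor Ψ).comp (coactDefect ρ R Φ) + Series.const ρ := by
    rw [coactDefect, Series.comp_sub, ← Series.comp_assoc _ _ (Series.const ρ),
      Series.id_tensor_comp, h2, Series.id_tensor_id, Series.id_comp, sub_add_cancel]
  have eP : Ψ.comp (P.comp (Φ.tensor Φ)) =
      Ψ.comp (mulDefect P Φ) + Series.const (LinearMap.mul' K A) := by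
    rw [mulDefect, Series.comp_sub, ← Series.comp_assoc Ψ Φ, h2, Series.id_comp, sub_add_cancel]
  have hm := hc.pairCochain_mem_cocycles hn
    (by
      rw [eR]
      intro i hi hin
      rw [Pi.add_apply, hR.comp_right _ i hin, Series.const_of_ne_zero _ hi, add_zero])
    (by
      rw [eP]
      intro i hi hin
      rw [Pi.add_apply, hP.comp_right _ i hin, Series.const_of_ne_zero _ hi, add_zero])
  rw [eR, eP, Pi.add_apply, Pi.add_apply, Series.const_of_ne_zero _ hn,
    Series.const_of_ne_zero _ hn, add_zero, add_zero, hR.comp_right_apply, hP.comp_right_apply, hΨ,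
    Series.tensor_zero, hΨ, Series.id_zero, TensorProduct.map_id, LinearMap.id_comp,
    LinearMap.id_comp] at hm
  exact hm

/-- `Φ` has constant term the identity, its other coefficients are derivations, and it trivializes
the deformation `(R, P)` modulo `t^n`. -/
structure Trivializes (ρ : A →ₗ[K] H ⊗[K] A) (R : Series K A (H ⊗[K] A))
    (P : Series K (A ⊗[K] A) A) (n : ℕ) (Φ : Series K A A) : Prop where
  zero : Φ 0 = LinearMap.id
  derivation : ∀ i, i ≠ 0 → Φ i ∈ Der K A
  coact : Series.VanishBelow n (coactDefect ρ R Φ)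
  mul : Series.VanishBelow n (mulDefect P Φ)

/-- The defect cocycle is a coboundary: its multiplication part is already zero, and its coaction
part comes from a derivation `φ`, removed by adding `-φ t^n`, which leaves the multiplication part
untouched. -/
theorem Trivializes.exists_succ (hH : cocycles Δ ρ 2 ≤ coboundaries Δ ρ 2)
    (h : IsDeformation Δ ρ R P) {n : ℕ} (hn : n ≠ 0) {Φ : Series K A A}
    (hΦ : Trivializes ρ R P n Φ) :
    ∃ Φ', Trivializes ρ R P (n + 1) Φ' ∧ ∀ i < n, Φ' i = Φ i := by
  obtain ⟨hm, φ, hφ, hr⟩ := (pairCochain_mem_coboundaries_iff _ _).mp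
    (hH (pairCochain_defect_mem_cocycles h hn hΦ.zero hΦ.coact hΦ.mul))
  let S : Series K A A := Pi.single n (-φ)
  have hS : Series.VanishBelow n S := fun i hi => Pi.single_eq_of_ne hi.ne _
  have hSn : S n = -φ := Pi.single_eq_same _ _
  have hlow : ∀ i < n, (Φ + S) i = Φ i := fun i hi => by rw [Pi.add_apply, hS i hi, add_zero]
  refine ⟨Φ + S, ⟨?_, ?_, ?_, ?_⟩, hlow⟩
  · rw [hlow 0 (Nat.pos_of_ne_zero hn), hΦ.zero]
  · intro i hi
    refine add_mem (hΦ.derivation i hi) ?_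
    by_cases hin : i = n
    · rw [hin, hSn]; exact neg_mem hφ
    · rw [show S i = 0 from Pi.single_eq_of_ne hin _]; exact zero_mem _
  · intro i hi
    rcases Nat.lt_succ_iff_lt_or_eq.mp hi with hi | rfl
    · rw [coactDefect_congr fun j hj => hlow j (hj.trans_lt hi), hΦ.coact i hi]
    · rw [coactDefect_add_apply h hS, hr, hSn, LinearMap.lTensor_neg, LinearMap.neg_comp,
        LinearMap.comp_neg]
      abel
  · intro i hi
    rcases Nat.lt_succ_iff_lt_or_eq.mp hi with hi | rfl
    · rw [mulDefect_congr fun j hj => hlow j (hj.trans_lt hi), hΦ.mul i hi]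
    · rw [mulDefect_add_apply h hn hΦ.zero hS (by rw [hSn]; exact neg_mem hφ), hm]

theorem trivializes_one_id (h : IsDeformation Δ ρ R P) :
    Trivializes ρ R P 1 (Series.id K A) where
  zero := rfl
  derivation i hi := by
    rw [Series.id, Series.const_of_ne_zero _ hi]; exact zero_mem _
  coact i hi := by
    obtain rfl := Nat.lt_one_iff.mp hi
    rw [coactDefect, Series.comp_id, Series.id_tensor_id, Series.id_comp, Pi.sub_apply,
      h.coact_zero, Series.const_zero, sub_self]
  mul i hi := by
    obtain rfl := Nat.lt_one_iff.mp hi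
    rw [mulDefect, Series.id_tensor_id, Series.comp_id, Series.id_comp, Pi.sub_apply,
      h.mul_zero, Series.const_zero, sub_self]

theorem exists_trivializes (hH : cocycles Δ ρ 2 ≤ coboundaries Δ ρ 2)
    (h : IsDeformation Δ ρ R P) : ∃ Φ, ∀ n, Trivializes ρ R P n Φ := by
  -- `next` is made total, so the approximations are a plain recursion and their properties are
  -- proved afterwards.
  choose! next hnext hlow using fun (n : ℕ) (Φ : Series K A A)
    (hΦ : Trivializes ρ R P (n + 1) Φ) => hΦ.exists_succ hH h n.succ_ne_zero
  let G : ℕ → Series K A A := fun n => Nat.rec (Series.id K A) next n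
  have hG : ∀ n, Trivializes ρ R P (n + 1) (G n) := by
    intro n
    induction n with
    | zero => exact trivializes_one_id h
    | succ n ih => exact hnext n _ ih
  -- Passing from `G n` to the next approximation preserves all coefficients of degree at most `n`,
  -- so the diagonal `G i i` is the limit.
  have hstable : ∀ k i, G (i + k) i = G i i := by
    intro k i
    induction k with
    | zero => rfl
    | succ k ih => exact (hlow (i + k) _ (hG (i + k)) i (by omega)).trans ih
  have hagree : ∀ n, ∀ i ≤ n, G i i = G n i := by
    intro n i hi
    obtain ⟨k, rfl⟩ := Nat.exists_eq_add_of_le hi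
    exact (hstable k i).symm
  refine ⟨fun i => G i i, fun n => ⟨(hG 0).zero, fun i hi => (hG i).derivation i hi,
    fun i _ => ?_, fun i _ => ?_⟩⟩
  · rw [coactDefect_congr (hagree i), (hG i).coact i i.lt_succ_self]
  · rw [mulDefect_congr (hagree i), (hG i).mul i i.lt_succ_self]

theorem isRigid_of_cocycles_le_coboundaries (hH : cocycles Δ ρ 2 ≤ coboundaries Δ ρ 2) :
    IsRigid Δ ρ := by
  intro R P h
  obtain ⟨Φ, hΦ⟩ := exists_trivializes hH h
  obtain ⟨Ψ, -, h1, h2⟩ := Series.exists_inverse Φ (hΦ 0).zero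
  have hR : R.comp Φ = ((Series.id K H).tensor Φ).comp (Series.const ρ) :=
    sub_eq_zero.mp (funext fun n => (hΦ (n + 1)).coact n n.lt_succ_self)
  have hP : P.comp (Φ.tensor Φ) = Φ.comp (Series.const (LinearMap.mul' K A)) :=
    sub_eq_zero.mp (funext fun n => (hΦ (n + 1)).mul n n.lt_succ_self)
  -- All positive coefficients of `Φ` are derivations, more than a formal automorphism needs.
  refine ⟨Φ, Ψ, ⟨(hΦ 0).zero, fun n hn _ _ => (hΦ 0).derivation n (by omega)⟩, h1, h2, ?_, ?_⟩
  · rw [Series.comp_assoc, hR, ← Series.comp_assoc, Series.id_tensor_comp, h2,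
      Series.id_tensor_id, Series.id_comp]
  · rw [Series.comp_assoc, hP, ← Series.comp_assoc, h2, Series.id_comp]

end Deformation

end ComoduleAlgebraDeformation

theorem mainTheorem6 {K : Type w} [Field K] {H A : Type u}
    [NonUnitalRing H] [Module K H] [IsScalarTower K H H] [SMulCommClass K H H]
    [NonUnitalRing A] [Module K A] [IsScalarTower K A A] [SMulCommClass K A A]
    (Δ : H →ₗ[K] H ⊗[K] H) (hΔ : ComoduleAlgebraDeformation.IsBialgebra Δ)
    (ρ : A →ₗ[K] H ⊗[K] A) (hρ : ComoduleAlgebraDeformation.IsComoduleAlgebra Δ ρ) :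
    open ComoduleAlgebraDeformation in
    -- the entries form a bicomplex, with total complex the deformation complex
    ((∀ p q, d Δ ρ (p + 1) q ∘ₗ d Δ ρ p q = 0) ∧
      (∀ p q, v Δ ρ p (q + 1) ∘ₗ v Δ ρ p q = 0) ∧
      (∀ p q, d Δ ρ p (q + 1) ∘ₗ v Δ ρ p q + v Δ ρ (p + 1) q ∘ₗ d Δ ρ p q = 0) ∧
      (∀ n, totD Δ ρ (n + 1) ∘ₗ totD Δ ρ n = 0)) ∧
    -- infinitesimals are cocycles, and equivalent deformations have the same class
    (∃ hZ : ∀ (R : Series K A (H ⊗[K] A)) (P : Series K (A ⊗[K] A) A),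
        IsDeformation Δ ρ R P → infinitesimal R P ∈ cocycles Δ ρ 2,
      ∀ (R : Series K A (H ⊗[K] A)) (P : Series K (A ⊗[K] A) A)
        (R' : Series K A (H ⊗[K] A)) (P' : Series K (A ⊗[K] A) A)
        (h : IsDeformation Δ ρ R P) (h' : IsDeformation Δ ρ R' P'),
        Equivalent R P R' P' →
          (Submodule.Quotient.mk ⟨infinitesimal R P, hZ R P h⟩ : Cohomology Δ ρ 2) =
            Submodule.Quotient.mk ⟨infinitesimal R' P', hZ R' P' h'⟩) ∧
    -- vanishing of the second cohomology implies rigidity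
    (Subsingleton (Cohomology Δ ρ 2) → IsRigid Δ ρ) := by
  refine ⟨⟨ComoduleAlgebraDeformation.d_comp_d hρ, ComoduleAlgebraDeformation.v_comp_v hΔ hρ,
    ComoduleAlgebraDeformation.d_comp_v_add_v_comp_d hΔ hρ,
    ComoduleAlgebraDeformation.totD_comp_totD hΔ hρ⟩, ⟨fun R P h =>
      h.pairCochain_mem_cocycles one_ne_zero (fun i hi hi' => absurd (Nat.lt_one_iff.mp hi') hi)
        (fun i hi hi' => absurd (Nat.lt_one_iff.mp hi') hi), fun R P R' P' h h' e =>
      (Submodule.Quotient.eq _).mpr (e.infinitesimal_sub_mem h)⟩, fun hs => ?_⟩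
  refine ComoduleAlgebraDeformation.isRigid_of_cocycles_le_coboundaries fun x hx => ?_
  -- In a subsingleton quotient the class of the cocycle `x` equals zero, so `x` is a coboundary.
  have h := (Submodule.Quotient.mk_eq_zero
    ((ComoduleAlgebraDeformation.coboundaries Δ ρ 2).submoduleOf
      (ComoduleAlgebraDeformation.cocycles Δ ρ 2)) (x := ⟨x, hx⟩)).mp (hs.elim _ _)
  exact h
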